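/- For $x\in\mathbb R^n$ let $\|x\|_2$ be the Euclidean norm, and for $R>0$ let $\gamma_R$ be the discrete Gaussian on $\mathbb Z^n$, $\gamma_R(x)=e^{-\pi\|x\|_2^2/R^2}\big/\sum_{y\in\mathbb Z^n}e^{-\pi\|y\|_2^2/R^2}$. A probability measure $\mu$ on $\mathbb Z^n$ is an $\alpha$-dense piece of $\gamma_R$ ($0<\alpha\le 1$) if $\mu(x)\le\alpha^{-1}\gamma_R(x)$ for all $x\in\mathbb Z^n$. Write $\mathbb T^n=(\mathbb R/\mathbb Z)^n$, $(\tau_v\nu)(x)=\nu(x-v)$, $d_{\mathrm{TV}}(\mu,\nu)=\frac12\sum_{x\in\mathbb Z^n}|\mu(x)-\nu(x)|$, and let $\log$ be the logarithm to base $2$. There is an absolute constant $R_0$ such that the following holds for all integers $n\ge 1$ and $R\ge R_0$ with $R\ge n^{50}$. Set $M:=R^2$. Let $\alpha\in(0,1]$ be such that $S:=\log(2/\alpha)\le n\log R$. Let $\alpha_1,\dots,\alpha_M\in(0,1]$ satisfy $\prod_{i=1}^M\alpha_i\ge\alpha^M$, let $\mu_1,\dots,\mu_M$ be probability measures on $\mathbb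 Z^n$ such that each $\mu_i$ is an $\alpha_i$-dense piece of $\gamma_R$, and let $\nu:=\mu_1*\cdots*\mu_M$. Then there are an integer $m\ge 0$ with $m\le 14S$, frequencies $t_1,\dots,t_m\in\mathbb T^n$ and integers $k_1,\dots,k_m\ge 1$ such that: 1. $\displaystyle\prod_{j=1}^m k_j\le\Big(1000\Big(1+\frac{S}{\log R}\Big)\Big)^{672S}$; 2. for every $j\in\{1,\dots,m\}$ there are integers $0\le c_i<k_i$ for $i<j$ with $k_jt_j\equiv\sum_{i=1}^{j-1}c_it_i\pmod{\mathbb Z^n}$; 3. every $v\in\mathbb Z^n\setminus\{0\}$ with $\langle v,t_j\rangle\in\mathbb Z$ for all $j\in\{1,\dots,m\}$ and $\|v\|_2\le R^{1/3}$ satisfies $d_{\mathrm{TV}}(\nu,\tau_v\nu)\le R^{-1/50}$. -/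

import Mathlib

open MeasureTheory

noncomputable section

namespace LatticeTV

/-- The integer lattice `ℤⁿ`. -/
abbrev Lat (n : ℕ) : Type := Fin n → ℤ

/-- The torus `𝕋ⁿ = (ℝ/ℤ)ⁿ`, the dual group of `ℤⁿ`. -/
abbrev Torus (n : ℕ) : Type := Fin n → UnitAddCircle

/-- The Euclidean norm `‖x‖₂` of an integer vector. -/
def l2norm {n : ℕ} (x : Lat n) : ℝ :=
  ‖(WithLp.toLp 2 (fun i => (x i : ℝ)) : EuclideanSpace ℝ (Fin n))‖

/-- The pairing `⟨v, t⟩ = ∑ᵢ vᵢ tᵢ ∈ ℝ/ℤ` of `v ∈ ℤⁿ` with a frequency `t ∈ 𝕋ⁿ`; the condition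
`⟨v, t⟩ ∈ ℤ` on real representatives of `t` says that this element of `ℝ/ℤ` is `0`. -/
def pairing {n : ℕ} (v : Lat n) (t : Torus n) : UnitAddCircle :=
  ∑ i, v i • t i

/-- The Gaussian weight `ρ_R(x) = exp(-π ‖x‖₂² / R²)`. -/
def gaussianWeight {n : ℕ} (R : ℝ) (x : Lat n) : ℝ :=
  Real.exp (-Real.pi * l2norm x ^ 2 / R ^ 2)

/-- The discrete Gaussian mass function `γ_R(x) = ρ_R(x) / ∑_{y ∈ ℤⁿ} ρ_R(y)`. -/
def gaussianMass {n : ℕ} (R : ℝ) (x : Lat n) : ℝ :=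
  gaussianWeight R x / ∑' y : Lat n, gaussianWeight R y

/-- The discrete Gaussian `γ_R` of radius `R` on `ℤⁿ`, as a measure. -/
def discreteGaussian (n : ℕ) (R : ℝ) : Measure (Lat n) :=
  Measure.sum fun x => ENNReal.ofReal (gaussianMass R x) • Measure.dirac x

theorem l2norm_sq {n : ℕ} (x : Lat n) : l2norm x ^ 2 = ∑ i, (x i : ℝ) ^ 2 := by
  simp [l2norm, EuclideanSpace.norm_sq_eq]

theorem summable_gaussianWeight (n : ℕ) {R : ℝ} (hR : 0 < R) :
    Summable (gaussianWeight R : Lat n → ℝ) := by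
  have h1 : Summable fun k : ℤ => Real.exp (-Real.pi * (1 / R ^ 2) * (k : ℝ) ^ 2) := by
    have h := HurwitzKernelBounds.summable_f_int 0 0 (t := 1 / R ^ 2) (by positivity)
    refine h.congr fun k => ?_
    simp [HurwitzKernelBounds.f_int]
    ring_nf
  have hpi : Measure.pi (fun _ : Fin n => (Measure.count : Measure ℤ)) = Measure.count := by
    refine Measure.ext_of_singleton fun x => ?_
    rw [Measure.pi_singleton]; simp
  have h2 := Integrable.fintype_prod (ι := Fin n) (𝕜 := ℝ) (μ := fun _ => Measure.count)
    (E := ℤ) (f := fun _ (k : ℤ) => Real.exp (-Real.pi * (1 / R ^ 2) * (k : ℝ) ^ 2))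
    (fun _ => integrable_count_iff.2 h1.norm)
  rw [hpi, integrable_count_iff] at h2
  refine h2.congr fun x => ?_
  rw [← Real.exp_sum, gaussianWeight, l2norm_sq, ← Finset.mul_sum, Real.norm_eq_abs,
    Real.abs_exp]
  ring_nf

theorem discreteGaussian_singleton (n : ℕ) (R : ℝ) (x : Lat n) :
    (discreteGaussian n R).real {x} = gaussianMass R x := by
  have h0 : 0 ≤ gaussianMass R x :=
    div_nonneg (Real.exp_nonneg _) (tsum_nonneg fun _ => Real.exp_nonneg _)
  have : discreteGaussian n R {x} = ENNReal.ofReal (gaussianMass R x) := by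
    rw [discreteGaussian, Measure.sum_apply _ (measurableSet_singleton x), tsum_eq_single x]
    · simp
    · intro y hy; simp [hy]
  rw [Measure.real, this, ENNReal.toReal_ofReal h0]

/-- For `R > 0` the discrete Gaussian is a probability measure. -/
theorem isProbabilityMeasure_discreteGaussian (n : ℕ) {R : ℝ} (hR : 0 < R) :
    IsProbabilityMeasure (discreteGaussian n R) := by
  have hs := summable_gaussianWeight n hR
  have hpos : 0 < ∑' y : Lat n, gaussianWeight R y :=
    hs.tsum_pos (fun _ => Real.exp_nonneg _) 0 (Real.exp_pos _)
  refine ⟨?_⟩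
  rw [discreteGaussian, Measure.sum_apply _ MeasurableSet.univ]
  simp only [Measure.smul_apply, measure_univ, smul_eq_mul, mul_one]
  rw [← ENNReal.ofReal_tsum_of_nonneg]
  · simp only [gaussianMass]
    rw [tsum_div_const, div_self hpos.ne', ENNReal.ofReal_one]
  · exact fun x => div_nonneg (Real.exp_nonneg _) hpos.le
  · exact hs.div_const _

/-- `μ` is an `α`-dense piece of `ν`: `μ(x) ≤ α⁻¹ ν(x)` at every point `x`
(used for probability measures on a countable set and `0 < α ≤ 1`). -/
def IsDensePiece {X : Type*} [MeasurableSpace X] (α : ℝ) (μ ν : Measure X) : Prop :=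
  ∀ x, μ.real {x} ≤ α⁻¹ * ν.real {x}

/-- The convolution `μ₁ * ⋯ * μ_M` (the unit mass at `0` if `M = 0`). -/
def convolution {n M : ℕ} (μ : Fin M → Measure (Lat n)) : Measure (Lat n) :=
  (List.ofFn μ).foldr Measure.conv (Measure.dirac 0)

/-- The translate `τ_v ν`, given by `(τ_v ν)(x) = ν(x - v)`. -/
def translate {n : ℕ} (v : Lat n) (ν : Measure (Lat n)) : Measure (Lat n) :=
  ν.map (fun x => x + v)

/-- Total variation distance of two probability measures on `ℤⁿ`:
`½ ∑_{x ∈ ℤⁿ} |μ(x) - ν(x)|`. -/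
def dTV {n : ℕ} (μ ν : Measure (Lat n)) : ℝ :=
  (1 / 2) * ∑' x : Lat n, |μ.real {x} - ν.real {x}|

end LatticeTV

end

/-!
Write `μ̂ᵢ` for the Fourier transform of `μᵢ` and call `∑ᵢ (1 - |μ̂ᵢ(t)|²)` the defect of a
frequency `t`. Where the defect exceeds `R`, the transform of `ν = μ₁ * ⋯ * μ_M` is at most
`exp (-R / 2)`, so only the set `A` of frequencies of defect at most `R` matters. The theorem has
two halves: `A` lies within `R^(-73/100)` of a small finite subgroup of the torus, given by
generators with exact relations, and a vector `v` orthogonal to that subgroup is almost a period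
of `ν`.

*Structure of `A`.* The square root of the defect is subadditive, being an `L²` norm of
`|e(⟨x, t⟩) - e(⟨y, t⟩)|` (`one_sub_norm_ft_sq_sum_le`). If a family of frequencies of small
defect is dissociated at scale `r = R^(-3/4)`, its subset sums are `r`-separated and still have
small defect. Since the transform of `γ_R` decays like a Gaussian of width `1 / R`
(`exists_ft_discreteGaussian_decay`, by Poisson summation), these subset sums are almost
orthogonal characters for `γ_R`, and a large sieve inequality for dense pieces
(`sq_sum_norm_ft_le`), applied to the at least `M / 2` pieces whose transforms are large on
average, bounds their number by `8 / α²`. Hence such a family has at most `2 S + 1` members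
(`card_le_of_dissociated`).

To turn approximate relations into exact ones, choose a base `D` of size about
`1000 (1 + S / log R)` and build greedily a `Tower` of points `uⱼ ∈ A`, each followed by a maximal
run `uⱼ, D uⱼ, D² uⱼ, …` of multiples that keeps the family dissociated. When the run stops after
`lⱼ` steps, it stops because of a relation with coefficients in `{-1, 0, 1}`, that is, because a
multiple `kⱼ uⱼ` with `kⱼ ≤ 2 D^lⱼ` is close to a combination of earlier points; dividing the
error by `kⱼ` moves `uⱼ` to a point `tⱼ` that satisfies the relation exactly. The errors grow only
by a factor `1 + 4 / D` per step, which makes them harmless. A run is cut off once `D^lⱼ` exceeds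
`R^(1/10)`, as longer multiples would lose the small defect; then `uⱼ` is rounded to a torsion
point instead. The total run length is at most `B ≤ 2 S + 1`, which bounds both the number of
generators and `∏ kⱼ ≤ (2 D^10)^B`, and maximality of the tower puts every point of `A` near the
group generated by the `tⱼ` (`exists_generators`).

*Translation.* If `v` is orthogonal to all the `tⱼ` then `‖⟨v, t⟩‖` is at most `a = R^(-1/3)` for
`t ∈ A`. There are weights `w` on `ℤ` of total mass `O(a^(1/5))` whose Fourier series agrees with
`1 - e(θ)` for `‖θ‖ ≤ a` (`exists_difference_kernel`, from differences of the Fourier coefficients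
of a trapezoid). By Fourier inversion `ν - τ_v ν` is therefore pointwise within a multiple of
`exp (-R / 2)` of `∑ₚ w(p) τ_{pv} ν`, whose total mass is at most `∑ₚ |w(p)|`. Summing over a box
of polynomial size, outside which `ν` has negligible mass, bounds the total variation distance
(`dTV_translate_le`).
-/

noncomputable section

namespace LatticeTV

/-! ### Approximate relations made exact -/

section Tower

variable {G : Type*} [NormedAddCommGroup G]

/-- The integer with digits `f 0, …, f (L - 1)` in base `D`. -/
def digits (D L : ℕ) (f : ℕ → ℤ) : ℤ := ∑ a ∈ Finset.range L, f a * (D : ℤ) ^ a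

/-- The combination `∑ⱼ ∑ₐ e j a • Dᵃ uⱼ` over `j < m` and `a < l j`. -/
def combo (D m : ℕ) (l : ℕ → ℕ) (u : ℕ → G) (e : ℕ → ℕ → ℤ) : G :=
  ∑ j ∈ Finset.range m, digits D (l j) (e j) • u j

/-- The family `(Dᵃ uⱼ)` with `j < m` and `a < l j` is `r`-dissociated: no combination of its
members with coefficients in `{-1, 0, 1}`, not all zero, has norm below `r`. -/
def Dissociated (r : ℝ) (D m : ℕ) (l : ℕ → ℕ) (u : ℕ → G) : Prop :=
  ∀ e : ℕ → ℕ → ℤ, (∀ j a, |e j a| ≤ 1) → ‖combo D m l u e‖ < r → ∀ j < m, ∀ a < l j, e j a = 0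

/-- Points `uⱼ ∈ A` with runs of multiples `Dᵃ uⱼ`, `a < l j`, that together are dissociated, and
nearby points `tⱼ` such that `kⱼ tⱼ` lies exactly in the group generated by the earlier `tᵢ`. The
distance from `uⱼ` to `tⱼ` is measured relative to `D ^ (-lⱼ)`, as combinations involve multiples
of `uⱼ` up to about `D ^ (lⱼ - 1)`. -/
structure Tower (A : Set G) (r : ℝ) (D I m : ℕ) (l k : ℕ → ℕ) (u t : ℕ → G) : Prop where
  mem : ∀ j < m, u j ∈ A
  one_le : ∀ j < m, 1 ≤ l j
  le_I : ∀ j < m, l j ≤ I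
  diss : Dissociated r D m l u
  one_le_k : ∀ j < m, 1 ≤ k j
  k_le : ∀ j < m, k j ≤ 2 * D ^ (10 * l j)
  rel : ∀ j < m, ∃ b : ℕ → ℤ, k j • t j = ∑ i ∈ Finset.range j, b i • t i
  err : ∀ j < m, (D : ℝ) ^ l j * ‖u j - t j‖ ≤ 2 * r * (1 + 4 / D) ^ j

theorem digits_succ (D L : ℕ) (f : ℕ → ℤ) :
    digits D (L + 1) f = digits D L f + f L * (D : ℤ) ^ L := by
  simp [digits, Finset.sum_range_succ]

theorem abs_digits_le {D : ℕ} (hD : 2 ≤ D) (L : ℕ) (f : ℕ → ℤ) (hf : ∀ a, |f a| ≤ 1) :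
    |digits D L f| * D ≤ 2 * (D : ℤ) ^ L := by
  have h : |digits D L f| * ((D : ℤ) - 1) ≤ (D : ℤ) ^ L - 1 := by
    induction L with
    | zero => simp [digits]
    | succ L ih =>
      rw [digits_succ]
      have h1 : |digits D L f + f L * (D : ℤ) ^ L| ≤ |digits D L f| + (D : ℤ) ^ L := by
        refine (abs_add_le _ _).trans (add_le_add le_rfl ?_)
        rw [abs_mul, abs_of_nonneg (by positivity : (0 : ℤ) ≤ (D : ℤ) ^ L)]
        exact mul_le_of_le_one_left (by positivity) (hf L)
      have h2 : (2 : ℤ) ≤ D := by exact_mod_cast hD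
      calc _ ≤ (|digits D L f| + (D : ℤ) ^ L) * ((D : ℤ) - 1) := by gcongr; linarith
        _ ≤ (D : ℤ) ^ (L + 1) - 1 := by rw [add_mul, pow_succ]; linarith
  have h2 : (2 : ℤ) ≤ D := by exact_mod_cast hD
  nlinarith [abs_nonneg (digits D L f)]

theorem digits_smul (D L : ℕ) (f : ℕ → ℤ) (c : ℤ) :
    digits D L (fun a => c * f a) = c * digits D L f := by
  simp [digits, Finset.mul_sum, mul_assoc]

theorem combo_smul (D m : ℕ) (l : ℕ → ℕ) (u : ℕ → G) (e : ℕ → ℕ → ℤ) (c : ℤ) :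
    combo D m l u (fun j a => c * e j a) = c • combo D m l u e := by
  simp [combo, digits_smul, Finset.smul_sum, mul_smul]

/-- The errors `uⱼ - tⱼ` of a tower add up to a geometric sum. -/
theorem Tower.norm_combo_sub_le {A : Set G} {r : ℝ} {D I m : ℕ} {l k : ℕ → ℕ} {u t : ℕ → G}
    (hD : 2 ≤ D) (h : Tower A r D I m l k u t) (e : ℕ → ℕ → ℤ)
    (he : ∀ j a, |e j a| ≤ 1) :
    ‖combo D m l u e - combo D m l t e‖ ≤ r * (1 + 4 / D) ^ m - r := by
  have hD0 : (0 : ℝ) < D := by exact_mod_cast (by omega : 0 < D)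
  have hgeom : r * (1 + 4 / (D : ℝ)) ^ m - r =
      ∑ j ∈ Finset.range m, 2 / (D : ℝ) * (2 * r * (1 + 4 / D) ^ j) := by
    have := geom_sum_eq (x := 1 + 4 / (D : ℝ)) (by simp; omega) m
    rw [← Finset.mul_sum, ← Finset.mul_sum, this]
    field_simp
    ring
  rw [hgeom, combo, combo, ← Finset.sum_sub_distrib]
  refine (norm_sum_le _ _).trans (Finset.sum_le_sum fun j hj => ?_)
  rw [← smul_sub]
  have h1 := abs_digits_le hD (l j) (e j) (he j)
  have h2 : (|digits D (l j) (e j)| : ℝ) ≤ 2 / D * (D : ℝ) ^ l j := by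
    rw [div_mul_eq_mul_div, le_div_iff₀ hD0]
    exact_mod_cast h1
  calc _ ≤ |(digits D (l j) (e j) : ℝ)| * ‖u j - t j‖ := by
        have := norm_zsmul_le (digits D (l j) (e j)) (u j - t j)
        rwa [Int.norm_eq_abs] at this
    _ ≤ 2 / D * (D : ℝ) ^ l j * ‖u j - t j‖ := by gcongr
    _ ≤ _ := by
      rw [mul_assoc]
      exact mul_le_mul_of_nonneg_left (h.err j (Finset.mem_range.1 hj)) (by positivity)

/-- A point of `A` far from all combinations can be appended to a tower, as the bottom of a run
`x, D x, …, D^(L - 1) x` of maximal length `L ≤ I`. If `L < I`, a short relation determines `k x`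
with `k` about `D ^ L`; if `L = I`, the point is rounded to a torsion point of order dividing
`D ^ (10 * I)`. -/
theorem Tower.extend {A : Set G} {r : ℝ} {D I m : ℕ} {l k : ℕ → ℕ} {u t : ℕ → G}
    (hdiv : ∀ (z : G) (k : ℕ), 1 ≤ k → ∃ δ : G, k • δ = z ∧ ‖δ‖ ≤ ‖z‖ / k)
    (hone : ∀ z : G, ‖z‖ ≤ 1) (hr : 0 < r) (hD : 4 ≤ D) (hI : 1 ≤ I)
    (hfree : 1 ≤ 2 * r * (D : ℝ) ^ (9 * I))
    (h : Tower A r D I m l k u t) {x : G} (hx : x ∈ A)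
    (hfar : ∀ e : ℕ → ℕ → ℤ, (∀ j a, |e j a| ≤ 1) → r ≤ ‖x - combo D m l u e‖) :
    ∃ (l' k' : ℕ → ℕ) (u' t' : ℕ → G), Tower A r D I (m + 1) l' k' u' t' := by
  have hD0 : (0 : ℝ) < D := by exact_mod_cast (by omega : 0 < D)
  let P : ℕ → Prop := fun L => ∀ (e : ℕ → ℕ → ℤ) (f : ℕ → ℤ), (∀ j a, |e j a| ≤ 1) →
    (∀ a, |f a| ≤ 1) → ‖combo D m l u e + digits D L f • x‖ < r →
    (∀ j < m, ∀ a < l j, e j a = 0) ∧ ∀ a < L, f a = 0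
  have hsign : ∀ c : ℤ, |c| = 1 → ∀ z : G, ‖c • z‖ = ‖z‖ := by
    intro c hc z
    rcases (abs_eq (by norm_num)).1 hc with rfl | rfl <;> simp
  have habs : ∀ c d : ℤ, |c| = 1 → |d| ≤ 1 → |c * d| ≤ 1 := by
    intro c d hc hd; rwa [abs_mul, hc, one_mul]
  have hcase : ∀ c : ℤ, |c| ≤ 1 → c ≠ 0 → |c| = 1 := fun c h1 h2 =>
    le_antisymm h1 (Int.one_le_abs h2)
  have hP1 : P 1 := by
    intro e f he hf hlt
    simp only [digits, Finset.range_one, Finset.sum_singleton, pow_zero, mul_one] at hlt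
    have hf0 : f 0 = 0 := by
      by_contra hne
      have hc := hcase _ (hf 0) hne
      have h1 := hfar (fun j a => -f 0 * e j a) fun j a => habs _ _ (by rwa [abs_neg]) (he j a)
      rw [combo_smul, neg_smul, sub_neg_eq_add] at h1
      have hsq : f 0 * f 0 = 1 := by rw [← abs_mul_abs_self, hc, one_mul]
      have h2 : x + f 0 • combo D m l u e = f 0 • (combo D m l u e + f 0 • x) := by
        rw [smul_add, smul_smul, hsq, one_smul, add_comm]
      rw [h2, hsign _ hc] at h1
      linarith
    refine ⟨h.diss e he (by simpa [hf0] using hlt), fun a ha => ?_⟩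
    obtain rfl : a = 0 := by omega
    exact hf0
  -- It suffices to find a run length together with a nearby point that satisfies a relation.
  suffices H : ∃ (L K : ℕ) (b : ℕ → ℤ) (y : G), 1 ≤ L ∧ L ≤ I ∧ P L ∧ 1 ≤ K ∧ K ≤ 2 * D ^ (10 * L) ∧
      K • y = ∑ i ∈ Finset.range m, b i • t i ∧
      (D : ℝ) ^ L * ‖x - y‖ ≤ 2 * r * (1 + 4 / D) ^ m by
    obtain ⟨L, K, b, y, hL1, hLI, hPL, hK1, hK2, hrel, herr⟩ := H
    refine ⟨fun j => if j = m then L else l j, fun j => if j = m then K else k j,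
      fun j => if j = m then x else u j, fun j => if j = m then y else t j, ?_⟩
    have hlt : ∀ {j}, j < m + 1 → j ≠ m → j < m := fun h1 h2 => by omega
    have hsum : ∀ j ≤ m, ∀ b : ℕ → ℤ, ∑ i ∈ Finset.range j, b i • (if i = m then y else t i) =
        ∑ i ∈ Finset.range j, b i • t i := by
      intro j hj b
      refine Finset.sum_congr rfl fun i hi => ?_
      rw [if_neg (by have := Finset.mem_range.1 hi; omega)]
    refine ⟨?_, ?_, ?_, ?_, ?_, ?_, ?_, ?_⟩
    · intro j hj
      split_ifs with hjm
      exacts [hx, h.mem j (hlt hj hjm)]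
    · intro j hj
      split_ifs with hjm
      exacts [hL1, h.one_le j (hlt hj hjm)]
    · intro j hj
      split_ifs with hjm
      exacts [hLI, h.le_I j (hlt hj hjm)]
    · intro e he hlt'
      have hc : combo D (m + 1) (fun j => if j = m then L else l j)
          (fun j => if j = m then x else u j) e = combo D m l u e + digits D L (e m) • x := by
        rw [combo, Finset.sum_range_succ]
        simp only [if_true]
        congr 1
        refine Finset.sum_congr rfl fun i hi => ?_
        have : i ≠ m := by have := Finset.mem_range.1 hi; omega
        simp only [if_neg this]
      rw [hc] at hlt'
      obtain ⟨h1, h2⟩ := hPL e (e m) he (he m) hlt'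
      intro j hj a ha
      by_cases hjm : j = m
      · subst hjm
        exact h2 a (by simpa using ha)
      · exact h1 j (hlt hj hjm) a (by simpa [hjm] using ha)
    · intro j hj
      split_ifs with hjm
      exacts [hK1, h.one_le_k j (hlt hj hjm)]
    · intro j hj
      split_ifs with hjm
      exacts [hK2, h.k_le j (hlt hj hjm)]
    · intro j hj
      by_cases hjm : j = m
      · subst hjm
        exact ⟨b, by rw [hsum _ le_rfl]; simpa using hrel⟩
      · obtain ⟨b', hb'⟩ := h.rel j (hlt hj hjm)
        exact ⟨b', by rw [hsum _ (by omega)]; simpa [hjm] using hb'⟩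
    · intro j hj
      by_cases hjm : j = m
      · subst hjm; simpa using herr
      · simpa [hjm] using h.err j (hlt hj hjm)
  by_cases hPI : P I
  · obtain ⟨δ, hδ, hδn⟩ := hdiv (D ^ (10 * I) • x) (D ^ (10 * I)) (Nat.one_le_pow _ _ (by omega))
    refine ⟨I, D ^ (10 * I), 0, x - δ, hI, le_rfl, hPI,
      Nat.one_le_pow _ _ (by omega), by omega, ?_, ?_⟩
    · simp [smul_sub, hδ]
    · have h1 : ‖δ‖ ≤ 1 / (D : ℝ) ^ (10 * I) := by
        refine hδn.trans ?_
        push_cast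
        gcongr
        exact hone _
      have h2 : (D : ℝ) ^ I * (1 / (D : ℝ) ^ (10 * I)) * (D : ℝ) ^ (9 * I) = 1 := by
        rw [show 10 * I = I + 9 * I by ring, pow_add]
        field_simp
      have h3 : (1 : ℝ) ≤ (1 + 4 / (D : ℝ)) ^ m :=
        one_le_pow₀ (le_add_of_nonneg_right (by positivity))
      rw [sub_sub_cancel]
      calc (D : ℝ) ^ I * ‖δ‖ ≤ (D : ℝ) ^ I * (1 / (D : ℝ) ^ (10 * I)) := by gcongr
        _ ≤ (D : ℝ) ^ I * (1 / (D : ℝ) ^ (10 * I)) * (2 * r * (D : ℝ) ^ (9 * I)) :=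
          le_mul_of_one_le_right (by positivity) hfree
        _ = 2 * r := by linear_combination 2 * r * h2
        _ ≤ _ := le_mul_of_one_le_right (by positivity) h3
  · have hex : ∃ L, 1 ≤ L ∧ ¬ P L := ⟨I, hI, hPI⟩
    classical
    obtain ⟨hN1, hN⟩ := Nat.find_spec hex
    set N := Nat.find hex with hNdef
    have hN2 : N ≠ 1 := fun h => hN (h ▸ hP1)
    obtain ⟨L, hL⟩ : ∃ L, N = L + 1 := ⟨N - 1, by omega⟩
    have hL1 : 1 ≤ L := by omega
    have hPL : P L := by
      by_contra hcon
      exact Nat.find_min hex (by omega : L < N) ⟨hL1, hcon⟩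
    rw [hL] at hN
    simp only [P, not_forall] at hN
    obtain ⟨e, f, he, hf, hlt, hne⟩ := hN
    have hfL : f L ≠ 0 := by
      intro h0
      refine hne ?_
      rw [digits_succ, h0, zero_mul, add_zero] at hlt
      obtain ⟨h1, h2⟩ := hPL e f he hf hlt
      refine ⟨h1, fun a ha => ?_⟩
      rcases Nat.lt_succ_iff_lt_or_eq.1 ha with h | rfl
      exacts [h2 a h, h0]
    have hc := hcase _ (hf L) hfL
    set c := f L with hcdef
    have hcc : c * c = 1 := by rw [← abs_mul_abs_self, hc, one_mul]
    set e' : ℕ → ℕ → ℤ := fun j a => c * e j a with he'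
    have he'1 : ∀ j a, |e' j a| ≤ 1 := fun j a => habs _ _ hc (he j a)
    set g : ℕ → ℤ := fun a => c * f a with hg
    have hg1 : ∀ a, |g a| ≤ 1 := fun a => habs _ _ hc (hf a)
    have hlt2 : ‖combo D m l u e' + (digits D L g + (D : ℤ) ^ L) • x‖ < r := by
      have : combo D m l u e' + (digits D L g + (D : ℤ) ^ L) • x =
          c • (combo D m l u e + digits D (L + 1) f • x) := by
        rw [combo_smul, digits_smul, digits_succ, smul_add, smul_smul, mul_add, ← hcdef,
          ← mul_assoc, hcc, one_mul]
      rw [this, hsign _ hc]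
      exact hlt
    have hdig := abs_digits_le (by omega : 2 ≤ D) L g hg1
    have hD4 : (4 : ℤ) ≤ D := by exact_mod_cast hD
    have hdig2 : 2 * |digits D L g| ≤ (D : ℤ) ^ L := by nlinarith [abs_nonneg (digits D L g)]
    have hpos : (1 : ℤ) ≤ (D : ℤ) ^ L := one_le_pow₀ (by linarith)
    obtain ⟨K, hK⟩ : ∃ K : ℕ, (K : ℤ) = digits D L g + (D : ℤ) ^ L :=
      ⟨(digits D L g + (D : ℤ) ^ L).toNat, Int.toNat_of_nonneg (by
        linarith [neg_abs_le (digits D L g)])⟩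
    rw [← hK, natCast_zsmul] at hlt2
    have hKlow : (D : ℤ) ^ L ≤ 2 * K := by linarith [neg_abs_le (digits D L g)]
    have hKup : (K : ℤ) ≤ 2 * (D : ℤ) ^ L := by linarith [le_abs_self (digits D L g)]
    have hK1 : 1 ≤ K := by omega
    have hK0 : (0 : ℝ) < K := by exact_mod_cast hK1
    obtain ⟨δ, hδ, hδn⟩ := hdiv (K • x + combo D m l t e') K hK1
    have hz : ‖K • x + combo D m l t e'‖ ≤ r * (1 + 4 / D) ^ m := by
      have h1 := h.norm_combo_sub_le (by omega) e' he'1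
      calc ‖K • x + combo D m l t e'‖
          = ‖(combo D m l u e' + K • x) - (combo D m l u e' - combo D m l t e')‖ := by
            congr 1; abel
        _ ≤ ‖combo D m l u e' + K • x‖ + ‖combo D m l u e' - combo D m l t e'‖ := norm_sub_le _ _
        _ ≤ _ := by linarith
    refine ⟨L, K, fun i => -digits D (l i) (e' i), x - δ, hL1, ?_, hPL, hK1, ?_, ?_, ?_⟩
    · have : N ≤ I := Nat.find_min' hex ⟨hI, hPI⟩
      omega
    · have h1 : K ≤ 2 * D ^ L := by exact_mod_cast hKup
      exact h1.trans (Nat.mul_le_mul_left _ (Nat.pow_le_pow_right (by omega) (by omega)))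
    · rw [smul_sub, hδ]
      simp [combo]
    · rw [sub_sub_cancel]
      have hKlow' : (D : ℝ) ^ L ≤ 2 * K := by exact_mod_cast hKlow
      calc (D : ℝ) ^ L * ‖δ‖ ≤ 2 * K * (r * (1 + 4 / D) ^ m / K) := by
            gcongr
            exact hδn.trans (by gcongr)
        _ = _ := by field_simp

/-- In a chain of relations `kⱼ tⱼ ∈ ⟨tᵢ : i < j⟩`, the coefficients of an integer combination can
be reduced to the ranges `0 ≤ cᵢ < kᵢ`. -/
theorem exists_reduced_coeff {m : ℕ} {k : ℕ → ℕ} {t : ℕ → G} (hk : ∀ j < m, 1 ≤ k j)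
    (hrel : ∀ j < m, ∃ b : ℕ → ℤ, k j • t j = ∑ i ∈ Finset.range j, b i • t i) :
    ∀ j ≤ m, ∀ b : ℕ → ℤ, ∃ c : ℕ → ℕ, (∀ i < j, c i < k i) ∧
      ∑ i ∈ Finset.range j, b i • t i = ∑ i ∈ Finset.range j, c i • t i := by
  intro j
  induction j with
  | zero => intro _ b; exact ⟨0, by simp, by simp⟩
  | succ j ih =>
    intro hj b
    obtain ⟨b', hb'⟩ := hrel j (by omega)
    have hkj : (0 : ℤ) < k j := by exact_mod_cast hk j (by omega)
    obtain ⟨c, hc, hsum⟩ := ih (by omega) (fun i => b i + (b j / k j) * b' i)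
    obtain ⟨d, hd⟩ : ∃ d : ℕ, (d : ℤ) = b j % k j :=
      ⟨(b j % k j).toNat, Int.toNat_of_nonneg (Int.emod_nonneg _ hkj.ne')⟩
    refine ⟨fun i => if i = j then d else c i, fun i hi => ?_, ?_⟩
    · dsimp only
      split_ifs with hij
      · subst hij
        have := Int.emod_lt_of_pos (b i) hkj
        omega
      · exact hc i (by omega)
    · rw [Finset.sum_range_succ, Finset.sum_range_succ]
      have h1 : ∑ i ∈ Finset.range j, (if i = j then d else c i) • t i =
          ∑ i ∈ Finset.range j, c i • t i := by
        refine Finset.sum_congr rfl fun i hi => ?_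
        rw [if_neg (by have := Finset.mem_range.1 hi; omega)]
      have h2 : b j • t j = (b j / k j) • ∑ i ∈ Finset.range j, b' i • t i + d • t j := by
        rw [← hb', ← natCast_zsmul, ← natCast_zsmul, smul_smul, ← add_smul, hd]
        congr 1
        rw [mul_comm, Int.mul_ediv_add_emod]
      have h3 : (fun i => if i = j then d else c i) j = d := if_pos rfl
      rw [h1, ← hsum, h2, h3, ← add_assoc]
      congr 1
      simp only [add_smul, Finset.sum_add_distrib, Finset.smul_sum, mul_smul]

/-- If dissociated families built from multiples of points of `A` have at most `B` members, then
`A` lies in a small neighbourhood of a finite group with few generators of controlled orders. -/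
theorem exists_generators {A : Set G} {r : ℝ} {D I B : ℕ}
    (hdiv : ∀ (z : G) (k : ℕ), 1 ≤ k → ∃ δ : G, k • δ = z ∧ ‖δ‖ ≤ ‖z‖ / k)
    (hone : ∀ z : G, ‖z‖ ≤ 1) (hr : 0 < r) (hD : 4 ≤ D) (hI : 1 ≤ I)
    (hfree : 1 ≤ 2 * r * (D : ℝ) ^ (9 * I))
    (hB : ∀ (m : ℕ) (l : ℕ → ℕ) (u : ℕ → G), (∀ j < m, u j ∈ A) →
      (∀ j < m, l j ≤ I) → Dissociated r D m l u → ∑ j ∈ Finset.range m, l j ≤ B) :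
    ∃ (m : ℕ) (t : ℕ → G) (k : ℕ → ℕ), m ≤ B ∧ (∀ j < m, 1 ≤ k j) ∧
      ∏ j ∈ Finset.range m, k j ≤ (2 * D ^ 10) ^ B ∧
      (∀ j < m, ∃ c : ℕ → ℕ, (∀ i < j, c i < k i) ∧
        k j • t j = ∑ i ∈ Finset.range j, c i • t i) ∧
      ∀ x ∈ A, ∃ b : ℕ → ℤ,
        ‖x - ∑ i ∈ Finset.range m, b i • t i‖ ≤ r * (1 + 4 / D) ^ B := by
  have hlen : ∀ {m l k} {u t : ℕ → G}, Tower A r D I m l k u t → m ≤ B := by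
    intro m l k u t h
    calc m = ∑ j ∈ Finset.range m, 1 := by simp
      _ ≤ ∑ j ∈ Finset.range m, l j :=
        Finset.sum_le_sum fun j hj => h.one_le j (Finset.mem_range.1 hj)
      _ ≤ B := hB m l u h.mem h.le_I h.diss
  have h0 : ∃ (l k : ℕ → ℕ) (u t : ℕ → G), Tower A r D I 0 l k u t :=
    ⟨0, 0, 0, 0, by constructor <;> simp [Dissociated]⟩
  -- A tower of maximal height.
  obtain ⟨m, ⟨l, k, u, t, h⟩, hmax⟩ : ∃ m, (∃ (l k : ℕ → ℕ) (u t : ℕ → G),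
      Tower A r D I m l k u t) ∧ ¬ ∃ (l k : ℕ → ℕ) (u t : ℕ → G),
      Tower A r D I (m + 1) l k u t := by
    by_contra! hcon
    have hall : ∀ m, ∃ (l k : ℕ → ℕ) (u t : ℕ → G), Tower A r D I m l k u t := by
      intro m
      induction m with
      | zero => exact h0
      | succ m ih =>
        obtain ⟨l, k, u, t, h⟩ := ih
        exact hcon m ⟨l, k, u, t, h⟩
    obtain ⟨l, k, u, t, h⟩ := hall (B + 1)
    have := hlen h
    omega
  have hred := exists_reduced_coeff h.one_le_k h.rel
  refine ⟨m, t, k, hlen h, h.one_le_k, ?_, ?_, ?_⟩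
  · have hD1 : 1 ≤ 2 * D ^ 10 := by
      have := Nat.one_le_pow 10 D (by omega)
      omega
    calc ∏ j ∈ Finset.range m, k j ≤ ∏ j ∈ Finset.range m, (2 * D ^ 10) ^ l j := by
          refine Finset.prod_le_prod' fun j hj => ?_
          have hj' := Finset.mem_range.1 hj
          refine (h.k_le j hj').trans ?_
          rw [mul_pow, ← pow_mul]
          exact Nat.mul_le_mul_right _ (Nat.le_self_pow (by have := h.one_le j hj'; omega) 2)
      _ = (2 * D ^ 10) ^ ∑ j ∈ Finset.range m, l j := Finset.prod_pow_eq_pow_sum _ _ _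
      _ ≤ _ := Nat.pow_le_pow_right hD1 (hB m l u h.mem h.le_I h.diss)
  · intro j hj
    obtain ⟨b, hb⟩ := h.rel j hj
    obtain ⟨c, hc, hsum⟩ := hred j hj.le b
    exact ⟨c, hc, hb.trans hsum⟩
  · intro x hx
    obtain ⟨e, he, hlt⟩ : ∃ e : ℕ → ℕ → ℤ, (∀ j a, |e j a| ≤ 1) ∧ ‖x - combo D m l u e‖ < r := by
      by_contra! hcon
      exact hmax (h.extend hdiv hone hr hD hI hfree hx hcon)
    refine ⟨fun i => digits D (l i) (e i), ?_⟩
    have h1 := h.norm_combo_sub_le (by omega) e he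
    calc ‖x - combo D m l t e‖
        = ‖(x - combo D m l u e) + (combo D m l u e - combo D m l t e)‖ := by congr 1; abel
      _ ≤ ‖x - combo D m l u e‖ + ‖combo D m l u e - combo D m l t e‖ := norm_add_le _ _
      _ ≤ r * (1 + 4 / D) ^ m := by linarith
      _ ≤ _ := by
        gcongr
        · exact le_add_of_nonneg_right (by positivity)
        · exact hlen h

end Tower

/-! ### Characters and Fourier transforms of measures on `ℤⁿ` -/

/-- The character `e(⟨x, t⟩) = exp(2πi ⟨x, t⟩)`. -/
def chi {n : ℕ} (x : Lat n) (t : Torus n) : ℂ := UnitAddTorus.mFourier x t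

theorem chi_eq_prod {n : ℕ} (x : Lat n) (t : Torus n) : chi x t = ∏ i, fourier (x i) (t i) := rfl

theorem chi_eq_toCircle {n : ℕ} (x : Lat n) (t : Torus n) :
    chi x t = ((pairing x t).toCircle : ℂ) := by
  rw [chi_eq_prod, pairing]
  simp only [fourier_apply]
  have : ∀ s : Finset (Fin n), ∏ i ∈ s, ((AddCircle.toCircle (x i • t i) : Circle) : ℂ) =
      ((AddCircle.toCircle (∑ i ∈ s, x i • t i) : Circle) : ℂ) := by
    intro s
    induction s using Finset.cons_induction with
    | empty => simp
    | cons a s ha ih => rw [Finset.prod_cons, Finset.sum_cons, AddCircle.toCircle_add, ih]; simp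
  exact this _

theorem norm_chi {n : ℕ} (x : Lat n) (t : Torus n) : ‖chi x t‖ = 1 := by
  rw [chi_eq_toCircle, Circle.norm_coe]

theorem chi_add_left {n : ℕ} (x y : Lat n) (t : Torus n) : chi (x + y) t = chi x t * chi y t :=
  UnitAddTorus.mFourier_add

theorem chi_neg_left {n : ℕ} (x : Lat n) (t : Torus n) :
    chi (-x) t = (starRingEnd ℂ) (chi x t) := UnitAddTorus.mFourier_neg

theorem chi_zero_left {n : ℕ} (t : Torus n) : chi 0 t = 1 := by
  simp [chi, UnitAddTorus.mFourier_zero]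

theorem pairing_add_right {n : ℕ} (x : Lat n) (s t : Torus n) :
    pairing x (s + t) = pairing x s + pairing x t := by
  simp [pairing, Finset.sum_add_distrib]

theorem chi_add_right {n : ℕ} (x : Lat n) (s t : Torus n) :
    chi x (s + t) = chi x s * chi x t := by
  simp [chi_eq_toCircle, pairing_add_right, AddCircle.toCircle_add]

theorem chi_neg_right {n : ℕ} (x : Lat n) (t : Torus n) :
    chi x (-t) = (starRingEnd ℂ) (chi x t) := by
  rw [← chi_neg_left, chi_eq_toCircle, chi_eq_toCircle]
  simp [pairing]

theorem chi_zero_right {n : ℕ} (x : Lat n) : chi x 0 = 1 := by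
  simp [chi_eq_toCircle, pairing]

theorem chi_mul_conj {n : ℕ} (x : Lat n) (s t : Torus n) :
    chi x s * (starRingEnd ℂ) (chi x t) = chi x (s - t) := by
  rw [sub_eq_add_neg, chi_add_right, chi_neg_right]

theorem continuous_chi {n : ℕ} (x : Lat n) : Continuous (chi x) :=
  (UnitAddTorus.mFourier x).continuous

theorem integrable_of_norm_le {n : ℕ} {E : Type*} [NormedAddCommGroup E]
    [MeasurableSpace E] [BorelSpace E] [SecondCountableTopology E]
    (μ : Measure (Lat n)) [IsFiniteMeasure μ] {f : Lat n → E} (C : ℝ) (h : ∀ x, ‖f x‖ ≤ C) :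
    Integrable f μ :=
  Integrable.of_bound (Measurable.of_discrete.aestronglyMeasurable) C
    (Filter.Eventually.of_forall h)

theorem integrable_chi {n : ℕ} (μ : Measure (Lat n)) [IsFiniteMeasure μ] (t : Torus n) :
    Integrable (fun x => chi x t) μ :=
  integrable_of_norm_le μ 1 fun x => (norm_chi x t).le

/-- The Fourier transform `μ̂(t) = ∫ e(⟨x, t⟩) dμ(x)`. -/
def ft {n : ℕ} (μ : Measure (Lat n)) (t : Torus n) : ℂ := ∫ x, chi x t ∂μ

theorem norm_ft_le_one {n : ℕ} (μ : Measure (Lat n)) [IsProbabilityMeasure μ] (t : Torus n) :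
    ‖ft μ t‖ ≤ 1 := by
  refine (norm_integral_le_of_norm_le_const (C := 1)
    (Filter.Eventually.of_forall fun x => (norm_chi x t).le)).trans ?_
  simp

theorem ft_conv {n : ℕ} (μ ν : Measure (Lat n)) [IsProbabilityMeasure μ] [IsProbabilityMeasure ν]
    (t : Torus n) : ft (μ.conv ν) t = ft μ t * ft ν t := by
  rw [ft, integral_conv (integrable_chi _ t)]
  simp_rw [chi_add_left, integral_const_mul, integral_mul_const]
  rfl

theorem ft_dirac_zero {n : ℕ} (t : Torus n) : ft (Measure.dirac (0 : Lat n)) t = 1 := by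
  simp [ft, chi_zero_left]

theorem foldr_conv_induction {n : ℕ} (l : List (Measure (Lat n)))
    (hl : ∀ μ ∈ l, IsProbabilityMeasure μ) :
    IsProbabilityMeasure (l.foldr Measure.conv (Measure.dirac 0)) ∧
      ∀ t, ft (l.foldr Measure.conv (Measure.dirac 0)) t = (l.map fun μ => ft μ t).prod := by
  induction l with
  | nil => exact ⟨by rw [List.foldr_nil]; infer_instance, fun t => by simpa using ft_dirac_zero t⟩
  | cons μ l ih =>
    obtain ⟨h1, h2⟩ := ih fun ν hν => hl ν (List.mem_cons_of_mem _ hν)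
    have := hl μ List.mem_cons_self
    refine ⟨by rw [List.foldr_cons]; infer_instance, fun t => ?_⟩
    rw [List.foldr_cons, ft_conv, h2 t, List.map_cons, List.prod_cons]

theorem isProbabilityMeasure_convolution {n M : ℕ} (μ : Fin M → Measure (Lat n))
    (hμ : ∀ i, IsProbabilityMeasure (μ i)) : IsProbabilityMeasure (convolution μ) :=
  (foldr_conv_induction _ (by simpa [List.mem_ofFn] using hμ)).1

theorem ft_convolution {n M : ℕ} (μ : Fin M → Measure (Lat n))
    (hμ : ∀ i, IsProbabilityMeasure (μ i)) (t : Torus n) :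
    ft (convolution μ) t = ∏ i, ft (μ i) t := by
  rw [convolution, (foldr_conv_induction _ (by simpa [List.mem_ofFn] using hμ)).2 t,
    List.map_ofFn, List.prod_ofFn]
  rfl

/-- Tails of a convolution: if every factor has mass at most `p` outside the ball of radius `T`,
the convolution of `M` factors has mass at most `M p` outside the ball of radius `M T`. -/
theorem convolution_tail_le {n M : ℕ} (μ : Fin M → Measure (Lat n))
    (hμ : ∀ i, IsProbabilityMeasure (μ i)) {T p : ℝ}
    (hp : ∀ i, (μ i).real {x | T < ‖x‖} ≤ p) :
    (convolution μ).real {x | M * T < ‖x‖} ≤ M * p := by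
  have key : ∀ l : List (Measure (Lat n)), (∀ μ ∈ l, IsProbabilityMeasure μ) →
      (∀ μ ∈ l, μ.real {x | T < ‖x‖} ≤ p) →
      (l.foldr Measure.conv (Measure.dirac 0)).real {x | l.length * T < ‖x‖} ≤ l.length * p := by
    intro l
    induction l with
    | nil => intro _ _; simp [Measure.real]
    | cons μ l ih =>
      intro h1 h2
      have h1' := fun ν hν => h1 ν (List.mem_cons_of_mem _ hν)
      have ih' := ih h1' fun ν hν => h2 ν (List.mem_cons_of_mem _ hν)
      have := h1 μ List.mem_cons_self
      have hμ2 := h2 μ List.mem_cons_self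
      have := (foldr_conv_induction l h1').1
      set ν := l.foldr Measure.conv (Measure.dirac 0) with hν
      rw [List.foldr_cons, ← hν, Measure.conv, map_measureReal_apply (by fun_prop)
        (MeasurableSet.of_discrete)]
      have hsub : (fun x : Lat n × Lat n => x.1 + x.2) ⁻¹' {x | ((μ :: l).length : ℝ) * T < ‖x‖} ⊆
          ({x | T < ‖x‖} ×ˢ Set.univ) ∪ (Set.univ ×ˢ {x | (l.length : ℝ) * T < ‖x‖}) := by
        intro x hx
        by_contra hcon
        simp only [Set.mem_union, Set.mem_prod, Set.mem_ofPred_eq, Set.mem_univ, and_true,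
          true_and, not_or, not_lt, Set.mem_preimage, List.length_cons] at hcon hx
        have := norm_add_le x.1 x.2
        push_cast at hx
        linarith [hcon.1, hcon.2]
      refine (measureReal_mono hsub).trans ((measureReal_union_le _ _).trans ?_)
      rw [measureReal_prod_prod, measureReal_prod_prod]
      simp only [probReal_univ, mul_one, one_mul, List.length_cons]
      push_cast
      linarith
  have := key (List.ofFn μ) (by simpa [List.mem_ofFn] using hμ) (by simpa [List.mem_ofFn] using hp)
  rwa [List.length_ofFn] at this

theorem integrable_prod_of_norm_le {n : ℕ} {E : Type*} [NormedAddCommGroup E]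
    [MeasurableSpace E] [BorelSpace E] [SecondCountableTopology E]
    (μ : Measure (Lat n)) [IsFiniteMeasure μ] {f : Lat n × Lat n → E} (C : ℝ)
    (h : ∀ x, ‖f x‖ ≤ C) : Integrable f (μ.prod μ) :=
  Integrable.of_bound (Measurable.of_discrete.aestronglyMeasurable) C
    (Filter.Eventually.of_forall h)

theorem two_mul_one_sub_norm_ft_sq {n : ℕ} (μ : Measure (Lat n)) [IsProbabilityMeasure μ]
    (t : Torus n) : 2 * (1 - ‖ft μ t‖ ^ 2) = ∫ p, ‖chi p.1 t - chi p.2 t‖ ^ 2 ∂(μ.prod μ) := by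
  have h1 : ∀ p : Lat n × Lat n, ‖chi p.1 t - chi p.2 t‖ ^ 2 =
      2 - 2 * (chi p.1 t * (starRingEnd ℂ) (chi p.2 t)).re := by
    intro p
    rw [← Complex.normSq_eq_norm_sq, Complex.normSq_sub, Complex.normSq_eq_norm_sq,
      Complex.normSq_eq_norm_sq, norm_chi, norm_chi]
    ring
  have hint : Integrable (fun p : Lat n × Lat n => chi p.1 t * (starRingEnd ℂ) (chi p.2 t))
      (μ.prod μ) := integrable_prod_of_norm_le μ 1 fun p => by simp [norm_chi]
  have hre : Integrable (fun p : Lat n × Lat n =>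
      (chi p.1 t * (starRingEnd ℂ) (chi p.2 t)).re) (μ.prod μ) := hint.re
  simp_rw [h1]
  rw [integral_sub (integrable_const _) (hre.const_mul 2), integral_const_mul]
  have h2 : ∫ p : Lat n × Lat n, (chi p.1 t * (starRingEnd ℂ) (chi p.2 t)).re ∂(μ.prod μ) =
      ‖ft μ t‖ ^ 2 := by
    have h3 := integral_prod_mul (μ := μ) (ν := μ) (fun x => chi x t)
      (fun x => (starRingEnd ℂ) (chi x t))
    rw [integral_conj] at h3
    have h4 := integral_re hint
    rw [h3] at h4
    refine h4.trans ?_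
    change (ft μ t * (starRingEnd ℂ) (ft μ t)).re = _
    rw [Complex.mul_conj, Complex.ofReal_re, Complex.normSq_eq_norm_sq]
  rw [h2]
  simp
  ring

/-- The defect `1 - |μ̂(t)|²` is half the mean square of `e(⟨x, t⟩) - e(⟨y, t⟩)` for independent
`x` and `y`, and the modulus of this difference is subadditive in `t`; Cauchy-Schwarz costs a
factor `|s|`. -/
theorem one_sub_norm_ft_sq_sum_le {n : ℕ} (μ : Measure (Lat n)) [IsProbabilityMeasure μ]
    {ι : Type*} (s : Finset ι) (f : ι → Torus n) :
    1 - ‖ft μ (∑ i ∈ s, f i)‖ ^ 2 ≤ s.card * ∑ i ∈ s, (1 - ‖ft μ (f i)‖ ^ 2) := by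
  have h1 : ∀ x y : Lat n, ∀ s : Finset ι,
      ‖chi x (∑ i ∈ s, f i) - chi y (∑ i ∈ s, f i)‖ ≤ ∑ i ∈ s, ‖chi x (f i) - chi y (f i)‖ := by
    intro x y s
    induction s using Finset.cons_induction with
    | empty => simp [chi_zero_right]
    | cons a s ha ih =>
      rw [Finset.sum_cons, Finset.sum_cons, chi_add_right, chi_add_right]
      calc _ = ‖(chi x (f a) - chi y (f a)) * chi x (∑ i ∈ s, f i) +
            chi y (f a) * (chi x (∑ i ∈ s, f i) - chi y (∑ i ∈ s, f i))‖ := by congr 1; ring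
        _ ≤ _ := by
          refine (norm_add_le _ _).trans ?_
          rw [norm_mul, norm_mul, norm_chi, norm_chi, mul_one, one_mul]
          gcongr
  have hb : ∀ t : Torus n, Integrable (fun p : Lat n × Lat n => ‖chi p.1 t - chi p.2 t‖ ^ 2)
      (μ.prod μ) := by
    intro t
    refine integrable_prod_of_norm_le μ 4 fun p => ?_
    have h2 : ‖chi p.1 t - chi p.2 t‖ ≤ 2 := by
      refine (norm_sub_le _ _).trans ?_
      rw [norm_chi, norm_chi]; norm_num
    rw [Real.norm_eq_abs, abs_of_nonneg (by positivity)]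
    nlinarith [norm_nonneg (chi p.1 t - chi p.2 t)]
  have h2 : 2 * (1 - ‖ft μ (∑ i ∈ s, f i)‖ ^ 2) ≤
      s.card * ∑ i ∈ s, 2 * (1 - ‖ft μ (f i)‖ ^ 2) := by
    simp_rw [two_mul_one_sub_norm_ft_sq]
    rw [← integral_finsetSum _ fun i _ => hb (f i), ← integral_const_mul]
    refine integral_mono (hb _) ((integrable_finsetSum _ fun i _ => hb (f i)).const_mul _) ?_
    intro p
    dsimp only
    calc _ ≤ (∑ i ∈ s, ‖chi p.1 (f i) - chi p.2 (f i)‖) ^ 2 := by gcongr; exact h1 _ _ _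
      _ ≤ _ := sq_sum_le_card_mul_sum_sq
  rw [← Finset.mul_sum] at h2
  linarith

/-! ### A summable sequence whose Fourier series is `1 - e(θ)` near `0` -/

theorem exists_real_representative (θ : UnitAddCircle) :
    ∃ y : ℝ, (y : UnitAddCircle) = θ ∧ |y| = ‖θ‖ := by
  obtain ⟨x, rfl⟩ := QuotientAddGroup.mk_surjective θ
  refine ⟨x - round x, ?_, (UnitAddCircle.norm_eq).symm⟩
  rw [AddCircle.coe_sub]
  refine sub_eq_self.2 ?_
  exact (AddCircle.coe_eq_zero_iff (1 : ℝ)).2 ⟨round x, by simp⟩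

theorem integral_cos_mul_eq_sinc (x : ℝ) : ∫ s in (0 : ℝ)..1, Real.cos (x * s) = Real.sinc x := by
  rcases eq_or_ne x 0 with rfl | hx
  · simp
  · rw [intervalIntegral.integral_comp_mul_left Real.cos hx, Real.sinc_of_ne_zero hx]
    simp [div_eq_inv_mul]

theorem abs_sinc_sub_sinc_le (x y : ℝ) : |Real.sinc x - Real.sinc y| ≤ |x - y| := by
  have hc : ∀ r : ℝ, IntervalIntegrable (fun s : ℝ => Real.cos (r * s)) volume 0 1 :=
    fun r => Continuous.intervalIntegrable (by fun_prop) _ _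
  rw [← integral_cos_mul_eq_sinc, ← integral_cos_mul_eq_sinc,
    ← intervalIntegral.integral_sub (hc x) (hc y)]
  have h := intervalIntegral.norm_integral_le_of_norm_le_const (a := (0 : ℝ)) (b := 1)
    (f := fun s => Real.cos (x * s) - Real.cos (y * s)) (C := |x - y|) fun s hs => by
      rw [Set.uIoc_of_le (by norm_num)] at hs
      have h1 : |x * s - y * s| ≤ |x - y| := by
        rw [← sub_mul, abs_mul, abs_of_pos hs.1]
        exact mul_le_of_le_one_right (abs_nonneg _) hs.2
      exact (Real.abs_cos_sub_cos_le _ _).trans h1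
  simpa using h

/-- The Fourier coefficients of the `1`-periodization of the even trapezoid function on `ℝ` that
equals `1` on `[-a, a]`, vanishes outside `[-2a, 2a]` and is affine in between: the convolution of
the indicators of `[-3a/2, 3a/2]` and `[-a/2, a/2]`, divided by `a`. -/
def trapezoidCoeff (a : ℝ) (p : ℤ) : ℝ :=
  3 * a * (Real.sinc (3 * Real.pi * a * p) * Real.sinc (Real.pi * a * p))

theorem trapezoidCoeff_eq {a : ℝ} (ha : 0 < a) {p : ℤ} (hp : p ≠ 0) :
    trapezoidCoeff a p =
      Real.sin (3 * Real.pi * a * p) * Real.sin (Real.pi * a * p) / (Real.pi ^ 2 * a * p ^ 2) := by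
  have hp' : (p : ℝ) ≠ 0 := by exact_mod_cast hp
  have := Real.pi_pos
  rw [trapezoidCoeff, Real.sinc_of_ne_zero (by positivity), Real.sinc_of_ne_zero (by positivity)]
  field_simp

theorem abs_trapezoidCoeff_le {a : ℝ} (ha : 0 < a) {p : ℤ} (hp : p ≠ 0) :
    |trapezoidCoeff a p| ≤ 1 / (9 * a * p ^ 2) := by
  have hp' : (p : ℝ) ≠ 0 := by exact_mod_cast hp
  have hpi := Real.pi_gt_three
  rw [trapezoidCoeff_eq ha hp, abs_div, abs_of_nonneg (by positivity : 0 ≤ Real.pi ^ 2 * a * p ^ 2),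
    abs_mul]
  gcongr
  · exact mul_le_one₀ (Real.abs_sin_le_one _) (abs_nonneg _) (Real.abs_sin_le_one _)
  · nlinarith

theorem trapezoidCoeff_zero (a : ℝ) : trapezoidCoeff a 0 = 3 * a := by simp [trapezoidCoeff]

theorem trapezoidCoeff_neg (a : ℝ) (p : ℤ) : trapezoidCoeff a (-p) = trapezoidCoeff a p := by
  simp [trapezoidCoeff]

theorem summable_trapezoidCoeff {a : ℝ} (ha : 0 < a) :
    Summable fun p : ℤ => |trapezoidCoeff a p| := by
  have h1 : Summable fun p : ℤ => 1 / (9 * a) * (1 / (p : ℝ) ^ 2) :=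
    (Real.summable_one_div_int_pow.2 (by norm_num)).mul_left _
  refine (summable_congr_cofinite ?_).1 (h1.of_norm_bounded_eventually
    (f := fun p : ℤ => if p = 0 then 0 else |trapezoidCoeff a p|)
    (Filter.Eventually.of_forall fun p => ?_))
  · filter_upwards [(Set.finite_singleton (0 : ℤ)).compl_mem_cofinite] with p hp
    simp only [Set.mem_compl_iff, Set.mem_singleton_iff] at hp
    simp [hp]
  · split_ifs with hp
    · simp; positivity
    · rw [Real.norm_eq_abs, abs_abs]
      refine (abs_trapezoidCoeff_le ha hp).trans (le_of_eq ?_)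
      rw [one_div_mul_one_div]

theorem hasSum_cos_div_sq {x : ℝ} (hx : x ∈ Set.Icc (0 : ℝ) 1) :
    HasSum (fun n : ℕ => 1 / (n : ℝ) ^ 2 * Real.cos (2 * Real.pi * n * x))
      (Real.pi ^ 2 * (x ^ 2 - x + 1 / 6)) := by
  have h := hasSum_one_div_nat_pow_mul_cos (k := 1) one_ne_zero hx
  convert! h using 1
  have : Polynomial.bernoulli 2 = Polynomial.X ^ 2 - Polynomial.X + Polynomial.C (1 / 6 : ℚ) := by
    refine Polynomial.funext fun y => ?_
    simp [Polynomial.bernoulli, Finset.sum_range_succ, bernoulli_eq_bernoulli'_of_ne_one]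
    ring
  rw [show 2 * 1 = 2 from rfl, this]
  have h6 : (algebraMap ℚ ℝ) (1 / 6) = 1 / 6 := by norm_num
  simp only [Polynomial.map_add, Polynomial.map_sub, Polynomial.map_pow, Polynomial.map_X,
    Polynomial.map_C, Polynomial.eval_add, Polynomial.eval_sub, Polynomial.eval_pow,
    Polynomial.eval_X, Polynomial.eval_C, Nat.factorial, h6]
  push_cast
  ring

/-- The periodized trapezoid equals `1` on `[-a, a]`. The product of sines in its coefficients is
a difference of cosines, which reduces the series to four values of the second Bernoulli
polynomial. -/
theorem tsum_trapezoidCoeff_mul_exp {a θ : ℝ} (ha : 0 < a) (ha3 : a ≤ 1 / 3) (hθ : |θ| ≤ a) :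
    ∑' p : ℤ, (trapezoidCoeff a p : ℂ) * Complex.exp (2 * Real.pi * Complex.I * p * θ) = 1 := by
  set f : ℤ → ℂ := fun p => (trapezoidCoeff a p : ℂ) * Complex.exp (2 * Real.pi * Complex.I * p * θ)
    with hf
  have hnorm : ∀ p : ℤ, ‖Complex.exp (2 * Real.pi * Complex.I * p * θ)‖ = 1 := by
    intro p
    rw [show (2 * Real.pi * Complex.I * p * θ : ℂ) = ((2 * Real.pi * p * θ : ℝ) : ℂ) * Complex.I by
      push_cast; ring, Complex.norm_exp_ofReal_mul_I]
  have hs : Summable f := by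
    refine Summable.of_norm ((summable_trapezoidCoeff ha).congr fun p => ?_)
    rw [hf, norm_mul, hnorm, mul_one, Complex.norm_real, Real.norm_eq_abs]
  have h1 := hs.hasSum.nat_add_neg
  obtain ⟨hθ1, hθ2⟩ := abs_le.1 hθ
  have hc1 := hasSum_cos_div_sq (x := a + θ) ⟨by linarith, by linarith⟩
  have hc2 := hasSum_cos_div_sq (x := a - θ) ⟨by linarith, by linarith⟩
  have hc3 := hasSum_cos_div_sq (x := 2 * a + θ) ⟨by linarith, by linarith⟩
  have hc4 := hasSum_cos_div_sq (x := 2 * a - θ) ⟨by linarith, by linarith⟩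
  have hc := ((((hc1.add hc2).sub hc3).sub hc4).mul_left (1 / (2 * Real.pi ^ 2 * a))).add
    (hasSum_ite_eq (0 : ℕ) (6 * a))
  have h2 : HasSum (fun n : ℕ => f n + f (-n)) ((1 + 3 * a : ℝ) : ℂ) := by
    have h3 := Complex.hasSum_ofReal.2 hc
    have hpi := Real.pi_ne_zero
    convert! h3 using 1
    · funext n
      have hsym : f n + f (-n) =
          ((2 * trapezoidCoeff a n * Real.cos (2 * Real.pi * n * θ) : ℝ) : ℂ) := by
        simp only [hf, trapezoidCoeff_neg]
        push_cast
        rw [Complex.cos]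
        ring_nf
      rw [hsym]
      congr 1
      rcases Nat.eq_zero_or_pos n with rfl | hn
      · simp [trapezoidCoeff_zero]; ring
      · have hn' : (n : ℤ) ≠ 0 := by exact_mod_cast hn.ne'
        have hn'' : (n : ℝ) ≠ 0 := by exact_mod_cast hn.ne'
        rw [trapezoidCoeff_eq ha hn', if_neg hn.ne', add_zero]
        have e1 : Real.sin (3 * Real.pi * a * (n : ℤ)) * Real.sin (Real.pi * a * (n : ℤ)) =
            (Real.cos (2 * Real.pi * n * a) - Real.cos (2 * Real.pi * n * (2 * a))) / 2 := by
          have := Real.cos_sub_cos (2 * Real.pi * n * a) (2 * Real.pi * n * (2 * a))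
          rw [this, show (2 * Real.pi * n * a + 2 * Real.pi * n * (2 * a)) / 2 =
            3 * Real.pi * a * (n : ℤ) by push_cast; ring,
            show (2 * Real.pi * n * a - 2 * Real.pi * n * (2 * a)) / 2 =
            -(Real.pi * a * (n : ℤ)) by push_cast; ring, Real.sin_neg]
          ring
        have e2 : ∀ b : ℝ, Real.cos (2 * Real.pi * n * (b + θ)) +
            Real.cos (2 * Real.pi * n * (b - θ)) =
            2 * (Real.cos (2 * Real.pi * n * b) * Real.cos (2 * Real.pi * n * θ)) := by
          intro b
          rw [mul_add, mul_sub, Real.cos_add, Real.cos_sub]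
          ring
        rw [e1]
        have e3 := e2 a
        have e4 := e2 (2 * a)
        have e5 : 2 * ((Real.cos (2 * Real.pi * n * a) - Real.cos (2 * Real.pi * n * (2 * a))) / 2 /
            (Real.pi ^ 2 * a * ((n : ℤ) : ℝ) ^ 2)) * Real.cos (2 * Real.pi * n * θ) =
            1 / (2 * Real.pi ^ 2 * a) * (1 / (n : ℝ) ^ 2) *
            (2 * (Real.cos (2 * Real.pi * n * a) * Real.cos (2 * Real.pi * n * θ)) -
              2 * (Real.cos (2 * Real.pi * n * (2 * a)) * Real.cos (2 * Real.pi * n * θ))) := by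
          push_cast
          generalize Real.cos (2 * Real.pi * n * (2 * a)) = z
          generalize Real.cos (2 * Real.pi * n * a) = z'
          generalize Real.cos (2 * Real.pi * n * θ) = z''
          field_simp
        rw [e5, ← e3, ← e4]
        ring
    · congr 1
      field_simp
      ring
  have h3 := h1.unique h2
  have h4 : f 0 = 3 * a := by simp [hf, trapezoidCoeff_zero]
  rw [h4] at h3
  push_cast at h3
  exact add_right_cancel h3

theorem abs_trapezoidCoeff_sub_le {a : ℝ} (ha : 0 < a) (p : ℤ) :
    |trapezoidCoeff a p - trapezoidCoeff a (p - 1)| ≤ 40 * a ^ 2 := by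
  have hpi := Real.pi_lt_d2
  have hpi0 := Real.pi_pos
  have h1 := abs_sinc_sub_sinc_le (3 * Real.pi * a * p) (3 * Real.pi * a * (p - 1 : ℤ))
  have h2 := abs_sinc_sub_sinc_le (Real.pi * a * p) (Real.pi * a * (p - 1 : ℤ))
  rw [← mul_sub] at h1 h2
  push_cast at h1 h2
  rw [sub_sub_cancel, mul_one] at h1 h2
  rw [abs_of_pos (by positivity : 0 < 3 * Real.pi * a)] at h1
  rw [abs_of_pos (by positivity : 0 < Real.pi * a)] at h2
  have h3 := Real.abs_sinc_le_one (Real.pi * a * p)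
  have h4 := Real.abs_sinc_le_one (3 * Real.pi * a * (p - 1))
  rw [trapezoidCoeff, trapezoidCoeff, ← mul_sub, abs_mul, abs_of_pos (by positivity : 0 < 3 * a)]
  push_cast
  set A := Real.sinc (3 * Real.pi * a * p)
  set B := Real.sinc (Real.pi * a * p)
  set A' := Real.sinc (3 * Real.pi * a * (p - 1))
  set B' := Real.sinc (Real.pi * a * (p - 1))
  have h5 : |A * B - A' * B'| ≤ 4 * Real.pi * a := by
    calc |A * B - A' * B'| = |(A - A') * B + A' * (B - B')| := by congr 1; ring
      _ ≤ |A - A'| * |B| + |A'| * |B - B'| := by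
        refine (abs_add_le _ _).trans ?_
        rw [abs_mul, abs_mul]
      _ ≤ 3 * Real.pi * a * 1 + 1 * (Real.pi * a) := by gcongr
      _ = _ := by ring
  calc 3 * a * |A * B - A' * B'| ≤ 3 * a * (4 * Real.pi * a) := by gcongr
    _ ≤ _ := by nlinarith [sq_nonneg a, pow_pos ha 2]

/-- The difference of consecutive trapezoid coefficients is small both by smoothness and by decay;
interpolating the two bounds gives a summable majorant with a small constant. -/
theorem abs_trapezoidCoeff_sub_le_rpow {a : ℝ} (ha : 0 < a) (ha3 : a ≤ 1 / 3) (p : ℤ) :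
    |trapezoidCoeff a p - trapezoidCoeff a (p - 1)| ≤
      40 * a ^ (1 / 5 : ℝ) * (|(p : ℝ)| ^ (-(6 / 5) : ℝ) + if p = 0 then 1 else 0) := by
  have h1 := abs_trapezoidCoeff_sub_le ha p
  set d := |trapezoidCoeff a p - trapezoidCoeff a (p - 1)| with hd
  have hd0 : 0 ≤ d := abs_nonneg _
  by_cases hp : p = 0
  · have h2 : a ^ 2 ≤ a ^ (1 / 5 : ℝ) := by
      rw [← Real.rpow_natCast]
      exact Real.rpow_le_rpow_of_exponent_ge ha (by linarith) (by norm_num)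
    subst hp
    simp only [Int.cast_zero, abs_zero, if_true]
    rw [Real.zero_rpow (by norm_num), zero_add, mul_one]
    linarith
  · rw [if_neg hp, add_zero]
    have hp1 : (1 : ℝ) ≤ (p : ℝ) ^ 2 := by
      have : (1 : ℤ) ≤ p ^ 2 := by have := Int.one_le_abs hp; nlinarith [sq_abs p]
      exact_mod_cast this
    have hpabs : (0 : ℝ) < |(p : ℝ)| := abs_pos.2 (by exact_mod_cast hp)
    have h2 : d ≤ 1 / (a * (p : ℝ) ^ 2) := by
      have e1 := abs_trapezoidCoeff_le ha hp
      have e2 : |trapezoidCoeff a (p - 1)| ≤ 4 / (9 * a * (p : ℝ) ^ 2) := by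
        by_cases hp2 : p - 1 = 0
        · obtain rfl : p = 1 := by omega
          rw [sub_self, trapezoidCoeff_zero, abs_of_pos (by positivity),
            le_div_iff₀ (by positivity)]
          norm_num
          nlinarith
        · refine (abs_trapezoidCoeff_le ha hp2).trans ?_
          have hq : (p : ℝ) ^ 2 ≤ 4 * ((p - 1 : ℤ) : ℝ) ^ 2 := by
            have : p ^ 2 ≤ 4 * (p - 1) ^ 2 := by
              have h5 : p ≤ 0 ∨ 2 ≤ p := by omega
              rcases h5 with h5 | h5 <;> nlinarith
            exact_mod_cast this
          have hq0 : (0 : ℝ) < ((p - 1 : ℤ) : ℝ) ^ 2 := by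
            have : ((p - 1 : ℤ) : ℝ) ≠ 0 := by exact_mod_cast hp2
            positivity
          rw [div_le_div_iff₀ (by positivity) (by positivity)]
          nlinarith
      calc d ≤ |trapezoidCoeff a p| + |trapezoidCoeff a (p - 1)| := abs_sub _ _
        _ ≤ 1 / (9 * a * (p : ℝ) ^ 2) + 4 / (9 * a * (p : ℝ) ^ 2) := add_le_add e1 e2
        _ = (5 / 9) * (1 / (a * (p : ℝ) ^ 2)) := by field_simp; norm_num
        _ ≤ 1 * (1 / (a * (p : ℝ) ^ 2)) := by gcongr; norm_num
        _ = _ := one_mul _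
    -- Weight `3 / 5` on the decay bound leaves the exponent `-6 / 5`, which is summable.
    have h3 : d = d ^ (2 / 5 : ℝ) * d ^ (3 / 5 : ℝ) := by
      rw [← Real.rpow_add_of_nonneg hd0 (by norm_num) (by norm_num)]
      norm_num
    have h4 : (40 * a ^ 2) ^ (2 / 5 : ℝ) ≤ 40 * a ^ (4 / 5 : ℝ) := by
      rw [Real.mul_rpow (by norm_num) (by positivity), ← Real.rpow_natCast a 2,
        ← Real.rpow_mul ha.le]
      norm_num
      gcongr
      calc (40 : ℝ) ^ (2 / 5 : ℝ) ≤ 40 ^ (1 : ℝ) :=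
            Real.rpow_le_rpow_of_exponent_le (by norm_num) (by norm_num)
        _ = 40 := Real.rpow_one _
    have h5 : (1 / (a * (p : ℝ) ^ 2)) ^ (3 / 5 : ℝ) =
        a ^ (-(3 / 5) : ℝ) * |(p : ℝ)| ^ (-(6 / 5) : ℝ) := by
      rw [one_div, Real.inv_rpow (by positivity), Real.mul_rpow ha.le (by positivity), ← sq_abs,
        ← Real.rpow_natCast |(p : ℝ)| 2, ← Real.rpow_mul hpabs.le, mul_inv, ← Real.rpow_neg ha.le,
        ← Real.rpow_neg hpabs.le]
      norm_num
    have h6 : a ^ (4 / 5 : ℝ) * a ^ (-(3 / 5) : ℝ) = a ^ (1 / 5 : ℝ) := by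
      rw [← Real.rpow_add ha]; norm_num
    calc d = d ^ (2 / 5 : ℝ) * d ^ (3 / 5 : ℝ) := h3
      _ ≤ (40 * a ^ 2) ^ (2 / 5 : ℝ) * (1 / (a * (p : ℝ) ^ 2)) ^ (3 / 5 : ℝ) := by gcongr
      _ ≤ 40 * a ^ (4 / 5 : ℝ) * (a ^ (-(3 / 5) : ℝ) * |(p : ℝ)| ^ (-(6 / 5) : ℝ)) := by
        rw [h5]; gcongr
      _ = _ := by rw [← h6]; ring

/-- There are absolutely summable weights of total mass `O(a^(1/5))` whose Fourier series agrees
with `1 - e(θ)` for `‖θ‖ ≤ a`. -/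
theorem exists_difference_kernel : ∃ C : ℝ, 0 < C ∧ ∀ a : ℝ, 0 < a → a ≤ 1 / 3 → ∃ w : ℤ → ℝ,
    Summable (fun p => |w p|) ∧ ∑' p, |w p| ≤ C * a ^ (1 / 5 : ℝ) ∧
    ∀ θ : UnitAddCircle, ‖θ‖ ≤ a → ∑' p : ℤ, (w p : ℂ) * fourier p θ = 1 - fourier 1 θ := by
  set g : ℤ → ℝ := fun p => |(p : ℝ)| ^ (-(6 / 5) : ℝ) + if p = 0 then 1 else 0 with hg
  have hgs : Summable g := by
    refine (Real.summable_abs_int_rpow (by norm_num)).add ?_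
    exact (hasSum_ite_eq (0 : ℤ) (1 : ℝ)).summable
  have hg0 : ∀ p, 0 ≤ g p := by
    intro p
    rw [hg]
    positivity
  have hgpos : 0 < ∑' p, g p := hgs.tsum_pos hg0 0 (by rw [hg]; simp)
  refine ⟨40 * ∑' p, g p, by positivity, fun a ha ha3 => ?_⟩
  -- Differencing the coefficients multiplies the series by `1 - e(θ)`, and the trapezoid is `1`
  -- near `0`.
  set w : ℤ → ℝ := fun p => trapezoidCoeff a p - trapezoidCoeff a (p - 1) with hw
  have hmaj : Summable fun p => 40 * a ^ (1 / 5 : ℝ) * g p := hgs.mul_left _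
  have hws : Summable fun p => |w p| :=
    Summable.of_nonneg_of_le (fun p => abs_nonneg _)
      (fun p => abs_trapezoidCoeff_sub_le_rpow ha ha3 p) hmaj
  refine ⟨w, hws, ?_, ?_⟩
  · calc ∑' p, |w p| ≤ ∑' p, 40 * a ^ (1 / 5 : ℝ) * g p :=
        hws.tsum_le_tsum (fun p => abs_trapezoidCoeff_sub_le_rpow ha ha3 p) hmaj
      _ = _ := by rw [tsum_mul_left]; ring
  · intro θ hθ
    obtain ⟨y, rfl, hy⟩ := exists_real_representative θ
    have hya : |y| ≤ a := hy.trans_le hθ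
    have hfour : ∀ p : ℤ, fourier p (y : UnitAddCircle) =
        Complex.exp (2 * Real.pi * Complex.I * p * y) := by
      intro p; rw [fourier_coe_apply]; simp
    simp_rw [hfour]
    have hT := tsum_trapezoidCoeff_mul_exp ha ha3 hya
    set E : ℤ → ℂ := fun p => Complex.exp (2 * Real.pi * Complex.I * p * y) with hE
    have hs : Summable fun p : ℤ => (trapezoidCoeff a p : ℂ) * E p := by
      refine Summable.of_norm ((summable_trapezoidCoeff ha).congr fun p => ?_)
      simp only [hE]
      rw [norm_mul, ← hfour, fourier_apply, Circle.norm_coe, mul_one, Complex.norm_real,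
        Real.norm_eq_abs]
    have hshift : ∀ p : ℤ, (trapezoidCoeff a (p - 1) : ℂ) * E p =
        E 1 * ((trapezoidCoeff a (p - 1) : ℂ) * E (p - 1)) := by
      intro p
      have : E p = E 1 * E (p - 1) := by
        simp only [hE]; rw [← Complex.exp_add]; push_cast; ring_nf
      rw [this]; ring
    have hs2 : Summable fun p : ℤ => (trapezoidCoeff a (p - 1) : ℂ) * E (p - 1) :=
      (Equiv.subRight (1 : ℤ)).summable_iff.2 hs
    have hT2 : ∑' p : ℤ, (trapezoidCoeff a (p - 1) : ℂ) * E (p - 1) = 1 := by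
      rw [← hT]
      exact (Equiv.subRight (1 : ℤ)).tsum_eq fun p : ℤ => (trapezoidCoeff a p : ℂ) * E p
    calc ∑' p : ℤ, (w p : ℂ) * E p
        = ∑' p : ℤ, ((trapezoidCoeff a p : ℂ) * E p -
            E 1 * ((trapezoidCoeff a (p - 1) : ℂ) * E (p - 1))) := by
          refine tsum_congr fun p => ?_
          rw [← hshift, hw]; push_cast; ring
      _ = 1 - E 1 := by rw [hs.tsum_sub (hs2.mul_left _), tsum_mul_left, hT2, hT, mul_one]
      _ = _ := by simp [hE]

/-! ### The discrete Gaussian: Fourier decay and tails -/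

/-- The one-dimensional theta series `∑ₖ exp(-π k² / R²) e(kθ)`. -/
def theta (R : ℝ) (θ : UnitAddCircle) : ℂ :=
  ∑' k : ℤ, (Real.exp (-Real.pi / R ^ 2 * (k : ℝ) ^ 2) : ℂ) * fourier k θ

/-- The total mass `∑ₖ exp(-π k² / R²)` of the one-dimensional Gaussian weight. -/
def thetaMass (R : ℝ) : ℝ := ∑' k : ℤ, Real.exp (-Real.pi / R ^ 2 * (k : ℝ) ^ 2)

theorem summable_exp_neg_int_sq {c : ℝ} (hc : 0 < c) :
    Summable fun k : ℤ => Real.exp (-Real.pi * c * (k : ℝ) ^ 2) := by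
  refine (HurwitzKernelBounds.summable_f_int 0 0 hc).congr fun k => ?_
  simp [HurwitzKernelBounds.f_int]
  ring_nf

theorem summable_thetaMass {R : ℝ} (hR : 0 < R) :
    Summable fun k : ℤ => Real.exp (-Real.pi / R ^ 2 * (k : ℝ) ^ 2) := by
  refine (summable_exp_neg_int_sq (c := 1 / R ^ 2) (by positivity)).congr fun k => ?_
  congr 1; ring

theorem thetaMass_pos {R : ℝ} (hR : 0 < R) : 0 < thetaMass R :=
  (summable_thetaMass hR).tsum_pos (fun _ => Real.exp_nonneg _) 0 (Real.exp_pos _)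

theorem norm_theta_term (R : ℝ) (θ : UnitAddCircle) (k : ℤ) :
    ‖(Real.exp (-Real.pi / R ^ 2 * (k : ℝ) ^ 2) : ℂ) * fourier k θ‖ =
      Real.exp (-Real.pi / R ^ 2 * (k : ℝ) ^ 2) := by
  rw [norm_mul, fourier_apply, Circle.norm_coe, mul_one, Complex.norm_real, Real.norm_eq_abs,
    Real.abs_exp]

theorem norm_theta_le {R : ℝ} (hR : 0 < R) (θ : UnitAddCircle) : ‖theta R θ‖ ≤ thetaMass R := by
  have hs : Summable fun k : ℤ =>
      ‖(Real.exp (-Real.pi / R ^ 2 * (k : ℝ) ^ 2) : ℂ) * fourier k θ‖ :=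
    (summable_thetaMass hR).congr fun k => (norm_theta_term R θ k).symm
  refine (norm_tsum_le_tsum_norm hs).trans (le_of_eq ?_)
  exact tsum_congr fun k => norm_theta_term R θ k

theorem thetaMass_eq {R : ℝ} (hR : 0 < R) :
    thetaMass R = R * ∑' k : ℤ, Real.exp (-Real.pi * R ^ 2 * (k : ℝ) ^ 2) := by
  have h := Real.tsum_exp_neg_mul_int_sq (a := 1 / R ^ 2) (by positivity)
  rw [← Real.sqrt_eq_rpow, Real.sqrt_div zero_le_one, Real.sqrt_one, Real.sqrt_sq hR.le] at h
  rw [thetaMass]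
  convert h using 1
  · refine tsum_congr fun k => ?_
    congr 1; ring
  · congr 1
    · simp
    · refine tsum_congr fun k => ?_
      congr 1
      field_simp

/-- By Poisson summation the theta series is a sum of Gaussians of width `1 / R` around the
integers. -/
theorem norm_theta_le_tsum {R : ℝ} (hR : 0 < R) (y : ℝ) :
    ‖theta R (y : UnitAddCircle)‖ ≤
      thetaMass R * ∑' k : ℤ, Real.exp (-Real.pi * R ^ 2 * (k - y : ℝ) ^ 2) := by
  have hR2 : 0 < 1 / R ^ 2 := by positivity
  have h := Complex.tsum_exp_neg_quadratic (a := ((1 / R ^ 2 : ℝ) : ℂ))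
    (by rwa [Complex.ofReal_re]) (Complex.I * y)
  have h1 : theta R (y : UnitAddCircle) = ∑' n : ℤ, Complex.exp (-Real.pi * ((1 / R ^ 2 : ℝ) : ℂ) *
      n ^ 2 + 2 * Real.pi * (Complex.I * y) * n) := by
    refine tsum_congr fun k => ?_
    rw [fourier_coe_apply, Complex.exp_add, Complex.ofReal_exp]
    congr 2
    · push_cast; ring
    · simp; ring
  have h2 : ∀ k : ℤ, Complex.exp (-Real.pi / ((1 / R ^ 2 : ℝ) : ℂ) *
      (k + Complex.I * (Complex.I * y)) ^ 2) =
      ((Real.exp (-Real.pi * R ^ 2 * (k - y : ℝ) ^ 2) : ℝ) : ℂ) := by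
    intro k
    rw [Complex.ofReal_exp]
    congr 1
    rw [← mul_assoc, Complex.I_mul_I]
    push_cast
    have : (R : ℂ) ≠ 0 := by exact_mod_cast hR.ne'
    field_simp
    ring
  have h3 : ‖(1 : ℂ) / ((1 / R ^ 2 : ℝ) : ℂ) ^ (1 / 2 : ℂ)‖ = R := by
    rw [norm_div, norm_one, show (1 / 2 : ℂ) = ((1 / 2 : ℝ) : ℂ) by push_cast; rfl,
      Complex.norm_cpow_eq_rpow_re_of_pos hR2, Complex.ofReal_re, ← Real.sqrt_eq_rpow,
      Real.sqrt_div zero_le_one, Real.sqrt_one, Real.sqrt_sq hR.le, one_div_one_div]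
  simp_rw [h2] at h
  rw [h1, h, norm_mul, h3, ← Complex.ofReal_tsum, Complex.norm_real, Real.norm_eq_abs,
    abs_of_nonneg (tsum_nonneg fun _ => Real.exp_nonneg _)]
  refine mul_le_mul_of_nonneg_right ?_ (tsum_nonneg fun _ => Real.exp_nonneg _)
  rw [thetaMass_eq hR]
  refine le_mul_of_one_le_right hR.le ?_
  have hs2 := summable_exp_neg_int_sq (c := R ^ 2) (by positivity)
  simpa using hs2.le_tsum 0 fun _ _ => Real.exp_nonneg _

/-- Each Gaussian in the Poisson sum is split into a factor decaying in `‖θ‖` and one summable in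
`k`, since both `‖θ‖` and `|k| / 2` are at most `|k - y|` when `|y| ≤ 1 / 2`. -/
theorem exists_theta_decay : ∃ C : ℝ, 0 < C ∧ ∀ (R : ℝ), 1 ≤ R → ∀ θ : UnitAddCircle,
    ‖theta R θ‖ ≤ thetaMass R * (C * Real.exp (-Real.pi * R ^ 2 * ‖θ‖ ^ 2 / 2)) := by
  have hsum := summable_exp_neg_int_sq (c := 1 / 8) (by norm_num)
  refine ⟨∑' k : ℤ, Real.exp (-Real.pi * (1 / 8) * (k : ℝ) ^ 2),
    hsum.tsum_pos (fun _ => Real.exp_nonneg _) 0 (Real.exp_pos _), fun R hR θ => ?_⟩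
  have hR0 : 0 < R := by linarith
  obtain ⟨y, rfl, hy⟩ := exists_real_representative θ
  have hhalf : |y| ≤ 1 / 2 := by
    rw [hy]
    simpa using AddCircle.norm_le_half_period (1 : ℝ) (x := (y : UnitAddCircle)) one_ne_zero
  have hterm : ∀ k : ℤ, Real.exp (-Real.pi * R ^ 2 * (k - y : ℝ) ^ 2) ≤
      Real.exp (-Real.pi * R ^ 2 * ‖(y : UnitAddCircle)‖ ^ 2 / 2) *
        Real.exp (-Real.pi * (1 / 8) * (k : ℝ) ^ 2) := by
    intro k
    rw [← Real.exp_add]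
    refine Real.exp_le_exp.2 ?_
    have h1 : ‖(y : UnitAddCircle)‖ ^ 2 ≤ (k - y : ℝ) ^ 2 := by
      rw [← sq_abs (k - y : ℝ), abs_sub_comm]
      refine pow_le_pow_left₀ (norm_nonneg _) ?_ 2
      rw [UnitAddCircle.norm_eq]
      exact round_le y k
    have h2 : (k : ℝ) ^ 2 / 4 ≤ (k - y : ℝ) ^ 2 := by
      rcases eq_or_ne k 0 with rfl | hk
      · simp; positivity
      · have h3 : (1 : ℝ) ≤ |(k : ℝ)| := by exact_mod_cast Int.one_le_abs hk
        have h4 : |(k : ℝ)| / 2 ≤ |(k - y : ℝ)| := by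
          have := abs_sub_abs_le_abs_sub (k : ℝ) y
          linarith
        have := pow_le_pow_left₀ (by positivity) h4 2
        rw [div_pow, sq_abs, sq_abs] at this
        linarith
    have hpi := Real.pi_pos
    have h5 : (k - y : ℝ) ^ 2 ≤ R ^ 2 * (k - y : ℝ) ^ 2 :=
      le_mul_of_one_le_left (sq_nonneg _) (one_le_pow₀ hR)
    have h6 : ‖(y : UnitAddCircle)‖ ^ 2 * R ^ 2 ≤ (k - y : ℝ) ^ 2 * R ^ 2 := by gcongr
    have h7 : R ^ 2 * ‖(y : UnitAddCircle)‖ ^ 2 / 2 + 1 / 8 * (k : ℝ) ^ 2 ≤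
        R ^ 2 * (k - y : ℝ) ^ 2 := by linarith
    have h8 := mul_le_mul_of_nonneg_left h7 hpi.le
    linarith
  have hmaj : Summable fun k : ℤ => Real.exp (-Real.pi * R ^ 2 * ‖(y : UnitAddCircle)‖ ^ 2 / 2) *
        Real.exp (-Real.pi * (1 / 8) * (k : ℝ) ^ 2) := hsum.mul_left _
  have hs := Summable.of_nonneg_of_le (fun _ => Real.exp_nonneg _) hterm hmaj
  refine (norm_theta_le_tsum hR0 y).trans ?_
  refine mul_le_mul_of_nonneg_left ?_ (thetaMass_pos hR0).le
  refine (hs.tsum_le_tsum hterm hmaj).trans (le_of_eq ?_)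
  rw [tsum_mul_left, mul_comm]

theorem thetaMass_sqrt_two_mul_le {R : ℝ} (hR : 0 < R) :
    thetaMass (√2 * R) ≤ 2 * thetaMass R := by
  have h2 : √2 ≤ 2 := by
    rw [Real.sqrt_le_left (by norm_num)]; norm_num
  rw [thetaMass_eq hR, thetaMass_eq (by positivity), ← mul_assoc]
  have hs1 := summable_exp_neg_int_sq (c := R ^ 2) (by positivity)
  have hs2 := summable_exp_neg_int_sq (c := (√2 * R) ^ 2) (by positivity)
  refine mul_le_mul (by gcongr) (hs2.tsum_le_tsum (fun k => ?_) hs1)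
    (tsum_nonneg fun _ => Real.exp_nonneg _) (by positivity)
  refine Real.exp_le_exp.2 ?_
  rw [mul_pow, Real.sq_sqrt (by norm_num)]
  have : 0 ≤ Real.pi * R ^ 2 * (k : ℝ) ^ 2 := by positivity
  linarith

theorem tsum_lat_prod {n : ℕ} (f : Fin n → ℤ → ℂ) (hf : ∀ i, Summable fun k => ‖f i k‖) :
    ∑' x : Lat n, ∏ i, f i (x i) = ∏ i, ∑' k, f i k := by
  have hpi : Measure.pi (fun _ : Fin n => (Measure.count : Measure ℤ)) = Measure.count := by
    refine Measure.ext_of_singleton fun x => ?_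
    rw [Measure.pi_singleton]; simp
  have h := integral_fintype_prod_eq_prod (μ := fun _ : Fin n => (Measure.count : Measure ℤ)) f
  have hint := Integrable.fintype_prod (μ := fun _ : Fin n => (Measure.count : Measure ℤ))
    (f := f) fun i => integrable_count_iff.2 (hf i)
  rw [hpi] at h hint
  rw [integral_countable hint] at h
  simp only [measureReal_def, Measure.count_singleton, ENNReal.toReal_one, one_smul] at h
  rw [h]
  refine Finset.prod_congr rfl fun i _ => ?_
  rw [integral_countable (integrable_count_iff.2 (hf i))]
  simp [measureReal_def]

theorem gaussianWeight_eq_prod {n : ℕ} (R : ℝ) (x : Lat n) :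
    gaussianWeight R x = ∏ i, Real.exp (-Real.pi / R ^ 2 * (x i : ℝ) ^ 2) := by
  rw [← Real.exp_sum, gaussianWeight, l2norm_sq, ← Finset.mul_sum]
  ring_nf

theorem tsum_gaussianWeight_mul_chi {n : ℕ} {R : ℝ} (hR : 0 < R) (t : Torus n) :
    ∑' x : Lat n, (gaussianWeight R x : ℂ) * chi x t = ∏ i, theta R (t i) := by
  simp only [theta]
  rw [← tsum_lat_prod _ fun i => (summable_thetaMass hR).congr fun k =>
    (norm_theta_term R (t i) k).symm]
  refine tsum_congr fun x => ?_
  rw [gaussianWeight_eq_prod, chi_eq_prod, Finset.prod_mul_distrib]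
  push_cast
  rfl

theorem tsum_gaussianWeight {n : ℕ} {R : ℝ} (hR : 0 < R) :
    ∑' x : Lat n, gaussianWeight R x = thetaMass R ^ n := by
  have h := tsum_gaussianWeight_mul_chi hR (0 : Torus n)
  simp only [chi_zero_right, mul_one, Pi.zero_apply] at h
  have h0 : theta R 0 = thetaMass R := by simp [theta, thetaMass, Complex.ofReal_tsum]
  rw [h0, Finset.prod_const, Finset.card_univ, Fintype.card_fin] at h
  exact_mod_cast h

theorem ft_discreteGaussian {n : ℕ} {R : ℝ} (hR : 0 < R) (t : Torus n) :
    ft (discreteGaussian n R) t = ∏ i, theta R (t i) / thetaMass R := by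
  have := isProbabilityMeasure_discreteGaussian n hR
  rw [ft, integral_countable (integrable_chi _ t), Finset.prod_div_distrib, Finset.prod_const,
    Finset.card_univ, Fintype.card_fin, ← tsum_gaussianWeight_mul_chi hR, ← tsum_div_const]
  refine tsum_congr fun x => ?_
  rw [discreteGaussian_singleton, gaussianMass, tsum_gaussianWeight hR, Complex.real_smul]
  push_cast
  ring

/-- The Fourier transform of the discrete Gaussian is tiny at distance much more than `1 / R` from
the origin of the torus. -/
theorem exists_ft_discreteGaussian_decay : ∃ C : ℝ, 0 < C ∧ ∀ (n : ℕ) (R : ℝ), 1 ≤ R →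
    ∀ (t : Torus n) (r : ℝ), 0 < r → r ≤ ‖t‖ →
      ‖ft (discreteGaussian n R) t‖ ≤ C * Real.exp (-Real.pi * R ^ 2 * r ^ 2 / 2) := by
  obtain ⟨C, hC, h⟩ := exists_theta_decay
  refine ⟨C, hC, fun n R hR t r hr hrt => ?_⟩
  have hR0 : 0 < R := by linarith
  have hm := thetaMass_pos hR0
  obtain ⟨i, hi⟩ : ∃ i, r ≤ ‖t i‖ := by
    by_contra! hcon
    exact absurd ((pi_norm_lt_iff hr).2 hcon) (not_lt.2 hrt)
  have hfac : ∀ j, ‖theta R (t j) / thetaMass R‖ = ‖theta R (t j)‖ / thetaMass R := fun j => by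
    rw [norm_div, Complex.norm_real, Real.norm_eq_abs, abs_of_pos hm]
  rw [ft_discreteGaussian hR0, norm_prod, ← Finset.mul_prod_erase _ _ (Finset.mem_univ i)]
  have h1 : ∏ j ∈ Finset.univ.erase i, ‖theta R (t j) / thetaMass R‖ ≤ 1 := by
    refine Finset.prod_le_one (fun _ _ => norm_nonneg _) fun j _ => ?_
    rw [hfac, div_le_one hm]
    exact norm_theta_le hR0 _
  refine (mul_le_of_le_one_right (norm_nonneg _) h1).trans ?_
  rw [hfac, div_le_iff₀ hm, mul_comm]
  refine (h R hR (t i)).trans ?_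
  refine mul_le_mul_of_nonneg_left (mul_le_mul_of_nonneg_left (Real.exp_le_exp.2 ?_) hC.le) hm.le
  have h2 : r ^ 2 ≤ ‖t i‖ ^ 2 := by gcongr
  have h3 : Real.pi * R ^ 2 * r ^ 2 ≤ Real.pi * R ^ 2 * ‖t i‖ ^ 2 := by gcongr
  linarith

theorem norm_le_l2norm {n : ℕ} (x : Lat n) : ‖x‖ ≤ l2norm x := by
  have h0 : 0 ≤ l2norm x := norm_nonneg _
  refine (pi_norm_le_iff_of_nonneg h0).2 fun i => ?_
  rw [Int.norm_eq_abs]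
  refine abs_le_of_sq_le_sq ?_ h0
  rw [l2norm_sq]
  exact Finset.single_le_sum (f := fun i => (x i : ℝ) ^ 2) (fun _ _ => sq_nonneg _)
    (Finset.mem_univ i)

theorem measureReal_eq_tsum_indicator {n : ℕ} (μ : Measure (Lat n)) [IsFiniteMeasure μ]
    (s : Set (Lat n)) : μ.real s = ∑' x, s.indicator (fun x => μ.real {x}) x := by
  rw [← integral_indicator_one (MeasurableSet.of_discrete), integral_countable
    (integrable_of_norm_le μ 1 fun x => ?_)]
  · refine tsum_congr fun x => ?_
    by_cases hx : x ∈ s <;> simp [hx]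
  · by_cases hx : x ∈ s <;> simp [hx]

theorem summable_measureReal_singleton {n : ℕ} (μ : Measure (Lat n)) [IsFiniteMeasure μ] :
    Summable fun x => μ.real {x} := by
  have h := ENNReal.summable_toReal (f := fun x => μ {x}) ?_
  · exact h
  · have h1 := lintegral_countable' (μ := μ) (fun _ => 1)
    simp only [lintegral_const, one_mul] at h1
    rw [← h1]
    exact measure_ne_top _ _

/-- A tail bound by an exponential moment: half of the exponent is spent on the condition
`T < ‖x‖`, the other half leaves a Gaussian of radius `√2 R`. -/
theorem discreteGaussian_tail {n : ℕ} {R T : ℝ} (hR : 0 < R) (hT : 0 ≤ T) :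
    (discreteGaussian n R).real {x | T < ‖x‖} ≤
      2 ^ n * Real.exp (-Real.pi * T ^ 2 / (2 * R ^ 2)) := by
  have := isProbabilityMeasure_discreteGaussian n hR
  have hm := thetaMass_pos hR
  have hs2 := summable_gaussianWeight n (R := √2 * R) (by positivity)
  have hterm : ∀ x : Lat n, Set.indicator {x | T < ‖x‖}
      (fun x => (discreteGaussian n R).real {x}) x ≤
      Real.exp (-Real.pi * T ^ 2 / (2 * R ^ 2)) / thetaMass R ^ n * gaussianWeight (√2 * R) x := by
    intro x
    refine Set.indicator_le' (s := {x : Lat n | T < ‖x‖})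
      (g := fun x => Real.exp (-Real.pi * T ^ 2 / (2 * R ^ 2)) / thetaMass R ^ n *
        gaussianWeight (√2 * R) x) (fun x hx => ?_) (fun x _ => ?_) x
    · rw [discreteGaussian_singleton, gaussianMass, tsum_gaussianWeight hR, div_mul_eq_mul_div]
      refine div_le_div_of_nonneg_right ?_ (by positivity)
      rw [gaussianWeight, gaussianWeight, ← Real.exp_add, mul_pow, Real.sq_sqrt (by norm_num)]
      refine Real.exp_le_exp.2 ?_
      have hx' : T < ‖x‖ := hx
      have h1 : T ^ 2 ≤ l2norm x ^ 2 := by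
        have := norm_le_l2norm x
        gcongr
        linarith
      rw [← add_div, div_le_div_iff₀ (by positivity) (by positivity)]
      have h2 : 0 ≤ Real.pi * R ^ 2 * (l2norm x ^ 2 - T ^ 2) :=
        mul_nonneg (by positivity) (by linarith)
      linarith
    · have := Real.exp_pos (-Real.pi * l2norm x ^ 2 / (√2 * R) ^ 2)
      exact mul_nonneg (by positivity) this.le
  rw [measureReal_eq_tsum_indicator]
  have hsl : Summable (Set.indicator {x : Lat n | T < ‖x‖}
      (fun x => (discreteGaussian n R).real {x})) :=
    (summable_measureReal_singleton _).indicator _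
  refine (hsl.tsum_le_tsum hterm (hs2.mul_left _)).trans ?_
  rw [tsum_mul_left, tsum_gaussianWeight (by positivity), div_mul_eq_mul_div,
    div_le_iff₀ (by positivity)]
  have h3 : thetaMass (√2 * R) ^ n ≤ (2 * thetaMass R) ^ n :=
    pow_le_pow_left₀ (thetaMass_pos (by positivity)).le (thetaMass_sqrt_two_mul_le hR) n
  calc _ ≤ Real.exp (-Real.pi * T ^ 2 / (2 * R ^ 2)) * (2 * thetaMass R) ^ n := by gcongr
    _ = _ := by rw [mul_pow]; ring

/-- A dense piece inherits upper bounds on masses of sets, with loss `α⁻¹`. -/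
theorem IsDensePiece.measureReal_le {n : ℕ} {α : ℝ} {μ ν : Measure (Lat n)} [IsFiniteMeasure μ]
    [IsFiniteMeasure ν] (h : IsDensePiece α μ ν) (s : Set (Lat n)) :
    μ.real s ≤ α⁻¹ * ν.real s := by
  rw [measureReal_eq_tsum_indicator, measureReal_eq_tsum_indicator, ← tsum_mul_left]
  refine Summable.tsum_le_tsum (fun x => ?_) ((summable_measureReal_singleton _).indicator _)
    (((summable_measureReal_singleton _).indicator _).mul_left _)
  by_cases hx : x ∈ s
  · simpa [hx] using h x
  · simp [hx]

theorem IsDensePiece.integral_le {n : ℕ} {α : ℝ} {μ ν : Measure (Lat n)} [IsFiniteMeasure μ]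
    [IsFiniteMeasure ν] (h : IsDensePiece α μ ν) {f : Lat n → ℝ} (hf0 : ∀ x, 0 ≤ f x) {C : ℝ}
    (hfC : ∀ x, f x ≤ C) : ∫ x, f x ∂μ ≤ α⁻¹ * ∫ x, f x ∂ν := by
  have hC : ∀ x, ‖f x‖ ≤ C := fun x => by
    rw [Real.norm_eq_abs, abs_of_nonneg (hf0 x)]; exact hfC x
  have hs : ∀ μ : Measure (Lat n), [IsFiniteMeasure μ] → Summable fun x => μ.real {x} • f x := by
    intro μ _
    refine Summable.of_nonneg_of_le (fun x => mul_nonneg measureReal_nonneg (hf0 x)) (fun x => ?_)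
      ((summable_measureReal_singleton μ).mul_right C)
    exact mul_le_mul_of_nonneg_left (hfC x) measureReal_nonneg
  rw [integral_countable (integrable_of_norm_le μ C hC),
    integral_countable (integrable_of_norm_le ν C hC), ← tsum_mul_left]
  refine Summable.tsum_le_tsum (fun x => ?_) (hs μ) ((hs ν).mul_left _)
  rw [smul_eq_mul, smul_eq_mul, ← mul_assoc]
  exact mul_le_mul_of_nonneg_right (h x) (hf0 x)

/-! ### Frequencies on which a dense piece is nearly constant -/

theorem sq_integral_le_integral_sq {n : ℕ} (μ : Measure (Lat n)) [IsProbabilityMeasure μ]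
    {f : Lat n → ℝ} {C : ℝ} (hf : ∀ x, |f x| ≤ C) : (∫ x, f x ∂μ) ^ 2 ≤ ∫ x, f x ^ 2 ∂μ := by
  set c := ∫ x, f x ∂μ with hc
  have h1 : Integrable f μ := integrable_of_norm_le μ C hf
  have h2 : Integrable (fun x => f x ^ 2) μ := integrable_of_norm_le μ (C ^ 2) fun x => by
    rw [Real.norm_eq_abs, abs_pow]
    exact pow_le_pow_left₀ (abs_nonneg _) (hf x) 2
  have h3 : 0 ≤ ∫ x, (f x ^ 2 - 2 * c * f x + c ^ 2) ∂μ :=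
    integral_nonneg fun x => by
      change 0 ≤ f x ^ 2 - 2 * c * f x + c ^ 2
      nlinarith [sq_nonneg (f x - c)]
  have h4 : Integrable (fun x => f x ^ 2 - 2 * c * f x) μ := h2.sub (h1.const_mul _)
  rw [integral_add h4 (integrable_const _), integral_sub h2 (h1.const_mul _), integral_const_mul,
    ← hc, integral_const, probReal_univ, one_smul] at h3
  linarith

/-- The large sieve for a dense piece: at frequencies that are almost orthogonal for `ν`, the
Fourier transform of a dense piece cannot be large on average. -/
theorem sq_sum_norm_ft_le {n : ℕ} {α ε : ℝ} {μ ν : Measure (Lat n)} [IsProbabilityMeasure μ]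
    [IsProbabilityMeasure ν] (hα : 0 < α) (h : IsDensePiece α μ ν) (U : Finset (Torus n))
    (hε : 0 ≤ ε) (hU : ∀ u ∈ U, ∀ u' ∈ U, u ≠ u' → ‖ft ν (u - u')‖ ≤ ε) :
    (∑ u ∈ U, ‖ft μ u‖) ^ 2 ≤ α⁻¹ * (U.card + (U.card : ℝ) ^ 2 * ε) := by
  have hc : ∀ z : ℂ, ∃ c : ℂ, ‖c‖ ≤ 1 ∧ c * z = ‖z‖ := by
    intro z
    rcases eq_or_ne z 0 with rfl | hz
    · exact ⟨0, by simp, by simp⟩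
    · have hz' : (‖z‖ : ℂ) ≠ 0 := by exact_mod_cast norm_ne_zero_iff.2 hz
      refine ⟨(starRingEnd ℂ) z / ‖z‖, ?_, ?_⟩
      · rw [norm_div, RCLike.norm_conj, Complex.norm_real, norm_norm,
          div_self (norm_ne_zero_iff.2 hz)]
      · rw [div_mul_eq_mul_div, div_eq_iff hz', mul_comm, Complex.mul_conj,
          Complex.normSq_eq_norm_sq]
        push_cast; ring
  choose c hc1 hc2 using hc
  -- `F` is the combination of characters whose phases align all the coefficients `μ̂(u)`.
  set F : Lat n → ℂ := fun x => ∑ u ∈ U, c (ft μ u) * chi x u with hF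
  have hFb : ∀ x, ‖F x‖ ≤ U.card := by
    intro x
    refine (norm_sum_le _ _).trans ?_
    calc _ ≤ ∑ u ∈ U, (1 : ℝ) := Finset.sum_le_sum fun u _ => by
          rw [norm_mul, norm_chi, mul_one]; exact hc1 _
      _ = _ := by simp
  have h1 : ∑ u ∈ U, ‖ft μ u‖ ≤ ∫ x, ‖F x‖ ∂μ := by
    have h2 : ∫ x, F x ∂μ = ((∑ u ∈ U, ‖ft μ u‖ : ℝ) : ℂ) := by
      rw [hF, integral_finsetSum _ fun u _ => (integrable_chi μ u).const_mul _]
      push_cast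
      exact Finset.sum_congr rfl fun u _ => by rw [integral_const_mul]; exact hc2 _
    have h3 := norm_integral_le_integral_norm (μ := μ) F
    rw [h2, Complex.norm_real, Real.norm_eq_abs] at h3
    exact (le_abs_self _).trans h3
  have h4 : ∫ x, ‖F x‖ ^ 2 ∂ν ≤ U.card + (U.card : ℝ) ^ 2 * ε := by
    have h5 : ∀ x, ((‖F x‖ ^ 2 : ℝ) : ℂ) = ∑ u ∈ U, ∑ u' ∈ U,
        c (ft μ u) * (starRingEnd ℂ) (c (ft μ u')) * chi x (u - u') := by
      intro x
      rw [← Complex.normSq_eq_norm_sq, ← Complex.mul_conj, hF]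
      simp only [map_sum, map_mul]
      rw [Finset.sum_mul_sum]
      refine Finset.sum_congr rfl fun u _ => Finset.sum_congr rfl fun u' _ => ?_
      rw [← chi_mul_conj]; ring
    have h6 : ((∫ x, ‖F x‖ ^ 2 ∂ν : ℝ) : ℂ) = ∑ u ∈ U, ∑ u' ∈ U,
        c (ft μ u) * (starRingEnd ℂ) (c (ft μ u')) * ft ν (u - u') := by
      rw [← integral_complex_ofReal]
      simp_rw [h5]
      rw [integral_finsetSum _ fun u _ => integrable_finsetSum _ fun u' _ =>
        (integrable_chi ν _).const_mul _]
      refine Finset.sum_congr rfl fun u _ => ?_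
      rw [integral_finsetSum _ fun u' _ => (integrable_chi ν _).const_mul _]
      exact Finset.sum_congr rfl fun u' _ => integral_const_mul _ _
    have h7 : ∫ x, ‖F x‖ ^ 2 ∂ν ≤ ∑ u ∈ U, ∑ u' ∈ U, ((if u = u' then 1 else 0) + ε) := by
      calc ∫ x, ‖F x‖ ^ 2 ∂ν ≤ ‖((∫ x, ‖F x‖ ^ 2 ∂ν : ℝ) : ℂ)‖ := by
            rw [Complex.norm_real]; exact le_abs_self _
        _ ≤ _ := by
          rw [h6]
          refine (norm_sum_le _ _).trans (Finset.sum_le_sum fun u hu => ?_)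
          refine (norm_sum_le _ _).trans (Finset.sum_le_sum fun u' hu' => ?_)
          rw [norm_mul, norm_mul, RCLike.norm_conj]
          have h8 : ‖c (ft μ u)‖ * ‖c (ft μ u')‖ ≤ 1 :=
            mul_le_one₀ (hc1 _) (norm_nonneg _) (hc1 _)
          refine (mul_le_of_le_one_left (norm_nonneg _) h8).trans ?_
          split_ifs with huu
          · linarith [norm_ft_le_one ν (u - u')]
          · rw [zero_add]; exact hU u hu u' hu' huu
    refine h7.trans (le_of_eq ?_)
    simp only [Finset.sum_add_distrib, Finset.sum_const, nsmul_eq_mul]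
    simp
    ring
  calc (∑ u ∈ U, ‖ft μ u‖) ^ 2 ≤ (∫ x, ‖F x‖ ∂μ) ^ 2 := by gcongr
    _ ≤ ∫ x, ‖F x‖ ^ 2 ∂μ := sq_integral_le_integral_sq μ (C := U.card) fun x => by
      rw [abs_norm]; exact hFb x
    _ ≤ α⁻¹ * ∫ x, ‖F x‖ ^ 2 ∂ν := h.integral_le (fun x => by positivity) (C := (U.card : ℝ) ^ 2)
      fun x => pow_le_pow_left₀ (norm_nonneg _) (hFb x) 2
    _ ≤ _ := by gcongr

/-- At least half of the pieces have average squared Fourier coefficient `≥ 1 / 2` over `U`; for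
each of those the large sieve forces density at most `8 / |U|`. -/
theorem card_mul_sq_le_of_defect_le {n M : ℕ} (hM : 0 < M) {α ε : ℝ} {ν : Measure (Lat n)}
    [IsProbabilityMeasure ν] {μ : Fin M → Measure (Lat n)} (hμ : ∀ i, IsProbabilityMeasure (μ i))
    {a : Fin M → ℝ} (ha : ∀ i, 0 < a i ∧ a i ≤ 1) (hα : 0 < α) (hα1 : α ≤ 1)
    (hprod : α ^ M ≤ ∏ i, a i) (hpiece : ∀ i, IsDensePiece (a i) (μ i) ν)
    (U : Finset (Torus n)) (hε : 0 ≤ ε) (hUε : U.card * ε ≤ 1)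
    (hU : ∀ u ∈ U, ∀ u' ∈ U, u ≠ u' → ‖ft ν (u - u')‖ ≤ ε)
    (hq : ∀ u ∈ U, ∑ i, (1 - ‖ft (μ i) u‖ ^ 2) ≤ (M : ℝ) / 4) :
    (U.card : ℝ) * α ^ 2 ≤ 8 := by
  by_contra! hcon
  set N : ℝ := (U.card : ℝ) with hN
  have hN0 : 0 < N := by
    by_contra! h
    have := mul_nonpos_of_nonpos_of_nonneg h (sq_nonneg α)
    linarith
  set A : Fin M → ℝ := fun i => ∑ u ∈ U, ‖ft (μ i) u‖ ^ 2 with hA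
  have hAN : ∀ i, A i ≤ N := fun i => by
    calc A i ≤ ∑ u ∈ U, (1 : ℝ) := Finset.sum_le_sum fun u _ =>
          pow_le_one₀ (norm_nonneg _) (norm_ft_le_one _ _)
      _ = N := by simp [hN]
  have hAsum : 3 / 4 * (M * N) ≤ ∑ i, A i := by
    have h1 : ∑ u ∈ U, ∑ i, (1 - ‖ft (μ i) u‖ ^ 2) ≤ ∑ u ∈ U, (M / 4 : ℝ) := Finset.sum_le_sum hq
    rw [Finset.sum_comm] at h1
    simp only [Finset.sum_sub_distrib, Finset.sum_const, Finset.card_univ, Fintype.card_fin,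
      nsmul_eq_mul, mul_one] at h1
    rw [hA]
    linarith
  -- The pieces whose mean square coefficient over `U` is at least `1 / 2`.
  set good : Finset (Fin M) := Finset.univ.filter fun i => N / 2 ≤ A i with hgood
  have hcard : (M : ℝ) ≤ 2 * good.card := by
    have h1 : ∑ i, A i ≤ ∑ i, (N / 2 + if N / 2 ≤ A i then N / 2 else 0) := by
      refine Finset.sum_le_sum fun i _ => ?_
      split_ifs with h
      · linarith [hAN i]
      · linarith
    rw [Finset.sum_add_distrib, ← Finset.sum_filter] at h1
    simp only [Finset.sum_const, Finset.card_univ, Fintype.card_fin, nsmul_eq_mul] at h1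
    have h2 : N * M ≤ N * (2 * good.card) := by linarith
    exact le_of_mul_le_mul_left h2 hN0
  have hcard' : M ≤ 2 * good.card := by exact_mod_cast hcard
  have hsmall : ∀ i ∈ good, a i ≤ 8 / N := by
    intro i hi
    have h1 : N / 2 ≤ A i := (Finset.mem_filter.1 hi).2
    have h2 : A i ≤ ∑ u ∈ U, ‖ft (μ i) u‖ := Finset.sum_le_sum fun u _ => by
      rw [sq]; exact mul_le_of_le_one_left (norm_nonneg _) (norm_ft_le_one _ _)
    have h3 := sq_sum_norm_ft_le (ha i).1 (hpiece i) U hε hU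
    have h4 : (N / 2) ^ 2 ≤ (∑ u ∈ U, ‖ft (μ i) u‖) ^ 2 := by gcongr; linarith
    have h5 : a i * (N / 2) ^ 2 ≤ N + N ^ 2 * ε := by
      have h6 := mul_le_mul_of_nonneg_left (h4.trans h3) (ha i).1.le
      rwa [← mul_assoc, mul_inv_cancel₀ (ha i).1.ne', one_mul] at h6
    have h7 : N ^ 2 * ε ≤ N := by nlinarith
    rw [le_div_iff₀ hN0]
    have h8 : N * (a i * N) ≤ N * 8 := by nlinarith
    exact le_of_mul_le_mul_left h8 hN0
  have h8N : 8 / N < α ^ 2 := by rw [div_lt_iff₀ hN0]; linarith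
  have hlast : α ^ M < α ^ M := by
    calc α ^ M ≤ ∏ i, a i := hprod
      _ ≤ ∏ i ∈ good, a i := by
        rw [← Finset.prod_sdiff (Finset.subset_univ good)]
        exact mul_le_of_le_one_left (Finset.prod_nonneg fun i _ => (ha i).1.le)
          (Finset.prod_le_one (fun i _ => (ha i).1.le) fun i _ => (ha i).2)
      _ ≤ ∏ i ∈ good, (8 / N) := Finset.prod_le_prod (fun i _ => (ha i).1.le) hsmall
      _ = (8 / N) ^ good.card := Finset.prod_const _
      _ < (α ^ 2) ^ good.card := pow_lt_pow_left₀ h8N (by positivity) (by omega)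
      _ = α ^ (2 * good.card) := (pow_mul _ _ _).symm
      _ ≤ α ^ M := pow_le_pow_of_le_one hα.le hα1 hcard'
  exact lt_irrefl _ hlast

/-- A dissociated family of frequencies with small defect has few members, because its subset sums
are well separated and still have small defect. -/
theorem card_le_of_dissociated {n M : ℕ} (hM : 0 < M) {α ε δ r : ℝ} {ν : Measure (Lat n)}
    [IsProbabilityMeasure ν] {μ : Fin M → Measure (Lat n)} (hμ : ∀ i, IsProbabilityMeasure (μ i))
    {a : Fin M → ℝ} (ha : ∀ i, 0 < a i ∧ a i ≤ 1) (hα : 0 < α) (hα1 : α ≤ 1)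
    (hprod : α ^ M ≤ ∏ i, a i) (hpiece : ∀ i, IsDensePiece (a i) (μ i) ν)
    (hr : 0 < r) (hε : 0 ≤ ε) (hdecay : ∀ t : Torus n, r ≤ ‖t‖ → ‖ft ν t‖ ≤ ε)
    {B : ℕ} (hB1 : 2 ^ (B + 1) * ε ≤ 1) (hB2 : ((B : ℝ) + 1) ^ 2 * δ ≤ 1 / 4)
    (hB3 : 8 < 2 ^ (B + 1) * α ^ 2)
    {ι : Type*} (s : Finset ι) (x : ι → Torus n)
    (hx : ∀ j ∈ s, ∑ i, (1 - ‖ft (μ i) (x j)‖ ^ 2) ≤ M * δ)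
    (hdis : ∀ e : ι → ℤ, (∀ j, |e j| ≤ 1) → ‖∑ j ∈ s, e j • x j‖ < r → ∀ j ∈ s, e j = 0) :
    s.card ≤ B := by
  classical
  by_contra! hcon
  obtain ⟨s', hs', hcard⟩ := Finset.exists_subset_card_eq (Nat.succ_le_of_lt hcon)
  have hdiff : ∀ p ⊆ s', ∀ p' ⊆ s', ‖∑ j ∈ p, x j - ∑ j ∈ p', x j‖ < r → p = p' := by
    intro p hp p' hp' hlt
    set e : ι → ℤ := fun j => (if j ∈ p then 1 else 0) - (if j ∈ p' then 1 else 0) with he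
    have he1 : ∀ j, |e j| ≤ 1 := by
      intro j; simp only [he]; split_ifs <;> simp
    have hsum : ∑ j ∈ s, e j • x j = ∑ j ∈ p, x j - ∑ j ∈ p', x j := by
      simp only [he, sub_smul, Finset.sum_sub_distrib, ite_smul, one_smul, zero_smul,
        Finset.sum_ite_mem, Finset.inter_eq_right.2 (hp.trans hs'),
        Finset.inter_eq_right.2 (hp'.trans hs')]
    have h0 := hdis e he1 (by rwa [hsum])
    ext j
    by_cases hj : j ∈ s
    · have := h0 j hj
      simp only [he] at this
      split_ifs at this with h1 h2 <;> simp_all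
    · exact ⟨fun h => absurd (hs' (hp h)) hj, fun h => absurd (hs' (hp' h)) hj⟩
  set U : Finset (Torus n) := s'.powerset.image fun p => ∑ j ∈ p, x j with hU
  have hUcard : U.card = 2 ^ (B + 1) := by
    rw [hU, Finset.card_image_of_injOn, Finset.card_powerset, hcard]
    intro p hp p' hp' hpp
    refine hdiff p (by simpa using hp) p' (by simpa using hp') ?_
    have hpp' : ∑ j ∈ p, x j = ∑ j ∈ p', x j := hpp
    rwa [hpp', sub_self, norm_zero]
  have hUc : (U.card : ℝ) = 2 ^ (B + 1) := by rw [hUcard]; push_cast; rfl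
  have h := card_mul_sq_le_of_defect_le hM hμ ha hα hα1 hprod hpiece U hε (by rwa [hUc]) ?_ ?_
  · rw [hUc] at h; linarith
  · intro u hu u' hu' huu
    obtain ⟨p, hp, rfl⟩ := Finset.mem_image.1 hu
    obtain ⟨p', hp', rfl⟩ := Finset.mem_image.1 hu'
    refine hdecay _ ?_
    by_contra! hlt
    exact huu (by rw [hdiff p (Finset.mem_powerset.1 hp) p' (Finset.mem_powerset.1 hp') hlt])
  · intro u hu
    obtain ⟨p, hp, rfl⟩ := Finset.mem_image.1 hu
    have hps : p ⊆ s' := Finset.mem_powerset.1 hp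
    have hpc : (p.card : ℝ) ≤ B + 1 := by
      have := Finset.card_le_card hps
      rw [hcard] at this
      exact_mod_cast this
    have hM0 : (0 : ℝ) < M := by exact_mod_cast hM
    have h1 : ∑ j ∈ p, ∑ i, (1 - ‖ft (μ i) (x j)‖ ^ 2) ≤ p.card * (M * δ) := by
      rw [← nsmul_eq_mul]
      exact Finset.sum_le_card_nsmul _ _ _ fun j hj => hx j (hs' (hps hj))
    have h3 : 0 ≤ ∑ j ∈ p, ∑ i, (1 - ‖ft (μ i) (x j)‖ ^ 2) :=
      Finset.sum_nonneg fun j _ => Finset.sum_nonneg fun i _ =>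
        sub_nonneg.2 (pow_le_one₀ (norm_nonneg _) (norm_ft_le_one _ _))
    calc ∑ i, (1 - ‖ft (μ i) (∑ j ∈ p, x j)‖ ^ 2)
        ≤ ∑ i, (p.card : ℝ) * ∑ j ∈ p, (1 - ‖ft (μ i) (x j)‖ ^ 2) :=
          Finset.sum_le_sum fun i _ => one_sub_norm_ft_sq_sum_le (μ i) p x
      _ = (p.card : ℝ) * ∑ j ∈ p, ∑ i, (1 - ‖ft (μ i) (x j)‖ ^ 2) := by
        rw [← Finset.mul_sum, Finset.sum_comm]
      _ ≤ ((B : ℝ) + 1) * ∑ j ∈ p, ∑ i, (1 - ‖ft (μ i) (x j)‖ ^ 2) := by gcongr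
      _ ≤ (M : ℝ) / 4 := by
        rcases Finset.eq_empty_or_nonempty p with rfl | hne
        · simp
          positivity
        · have hp0 : (0 : ℝ) < p.card := by exact_mod_cast hne.card_pos
          have h4 : 0 ≤ M * δ := by
            by_contra! hneg
            nlinarith
          calc _ ≤ ((B : ℝ) + 1) * ((B + 1) * (M * δ)) := by
                gcongr
                exact h1.trans (by gcongr)
            _ = M * (((B : ℝ) + 1) ^ 2 * δ) := by ring
            _ ≤ M * (1 / 4) := by gcongr
            _ = _ := by ring

theorem defect_nsmul_le {n : ℕ} (μ : Measure (Lat n)) [IsProbabilityMeasure μ] (N : ℕ)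
    (t : Torus n) : 1 - ‖ft μ (N • t)‖ ^ 2 ≤ (N : ℝ) ^ 2 * (1 - ‖ft μ t‖ ^ 2) := by
  have h := one_sub_norm_ft_sq_sum_le μ (Finset.range N) fun _ => t
  simp only [Finset.sum_const, Finset.card_range] at h
  have h1 : N • (1 - ‖ft μ t‖ ^ 2) = (N : ℝ) * (1 - ‖ft μ t‖ ^ 2) := nsmul_eq_mul _ _
  rw [h1] at h
  linarith

/-- The combination as a sum over the index set of the family `(Dᵃ uⱼ)`. -/
theorem combo_eq_sum_sigma {G : Type*} [NormedAddCommGroup G] (D m : ℕ) (l : ℕ → ℕ) (u : ℕ → G)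
    (e : ℕ → ℕ → ℤ) : combo D m l u e =
      ∑ p ∈ (Finset.range m).sigma fun j => Finset.range (l j),
        e p.1 p.2 • ((D ^ p.2) • u p.1) := by
  rw [Finset.sum_sigma, combo]
  refine Finset.sum_congr rfl fun j _ => ?_
  rw [digits, Finset.sum_smul]
  refine Finset.sum_congr rfl fun a _ => ?_
  rw [mul_smul, ← natCast_zsmul]
  push_cast
  rfl

/-- Every point of the torus can be divided by `k` with the expected shrinking of its norm. -/
theorem exists_nsmul_eq_norm_le {n : ℕ} (z : Torus n) (k : ℕ) (hk : 1 ≤ k) :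
    ∃ δ : Torus n, k • δ = z ∧ ‖δ‖ ≤ ‖z‖ / k := by
  have hk0 : (0 : ℝ) < k := by exact_mod_cast hk
  choose y hy hyn using fun i => exists_real_representative (z i)
  refine ⟨fun i => ((y i / k : ℝ) : UnitAddCircle), ?_, ?_⟩
  · ext i
    rw [Pi.smul_apply, ← AddCircle.coe_nsmul, nsmul_eq_mul, mul_div_cancel₀ _ hk0.ne', hy]
  · refine (pi_norm_le_iff_of_nonneg (by positivity)).2 fun i => ?_
    have h1 : ‖((y i / k : ℝ) : UnitAddCircle)‖ ≤ |y i / k| := by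
      rw [UnitAddCircle.norm_eq]
      simpa using round_le (y i / k) 0
    refine h1.trans ?_
    rw [abs_div, hyn, abs_of_pos hk0]
    gcongr
    exact norm_le_pi_norm z i

theorem norm_torus_le_one {n : ℕ} (z : Torus n) : ‖z‖ ≤ 1 := by
  refine (pi_norm_le_iff_of_nonneg zero_le_one).2 fun i => ?_
  refine (AddCircle.norm_le_half_period (1 : ℝ) one_ne_zero).trans ?_
  norm_num

/-! ### From Fourier decay to total variation -/

/-- The Haar probability measure on the torus. -/
def torusHaar (n : ℕ) : Measure (Torus n) := Measure.pi fun _ => AddCircle.haarAddCircle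

instance (n : ℕ) : IsProbabilityMeasure (torusHaar n) := by
  unfold torusHaar; infer_instance

instance (n : ℕ) : (torusHaar n).IsAddLeftInvariant := by
  unfold torusHaar; infer_instance

theorem integral_chi {n : ℕ} (x : Lat n) :
    ∫ t, chi x t ∂(torusHaar n) = if x = 0 then 1 else 0 := by
  split_ifs with hx
  · subst hx
    simp [chi_zero_left]
  · obtain ⟨i, hi⟩ := Function.ne_iff.1 hx
    set s : Torus n := Pi.single i ((1 / 2 / (x i : ℝ) : ℝ) : UnitAddCircle) with hs
    have hchi : chi x s = -1 := by
      rw [chi_eq_prod, ← Finset.mul_prod_erase _ _ (Finset.mem_univ i), Finset.prod_eq_one]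
      · have h := fourier_add_half_inv_index (T := 1) hi zero_lt_one 0
        rw [zero_add, fourier_eval_zero] at h
        rw [hs, Pi.single_eq_same, mul_one]
        exact h
      · intro j hj
        rw [hs, Pi.single_eq_of_ne (Finset.ne_of_mem_erase hj), fourier_eval_zero]
    have h := integral_add_left_eq_self (μ := torusHaar n) (fun t => chi x t) s
    simp_rw [chi_add_right, hchi, neg_one_mul] at h
    rw [integral_neg] at h
    exact self_eq_neg.1 h.symm

theorem continuous_ft {n : ℕ} (μ : Measure (Lat n)) [IsProbabilityMeasure μ] :
    Continuous (ft μ) := by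
  refine continuous_of_dominated (bound := fun _ => 1) (fun t => ?_) (fun t => ?_) ?_ ?_
  · exact (integrable_chi μ t).aestronglyMeasurable
  · exact Filter.Eventually.of_forall fun x => (norm_chi x t).le
  · exact integrable_const _
  · exact Filter.Eventually.of_forall fun x => continuous_chi x

/-- Fourier inversion on the torus. -/
theorem measureReal_singleton_eq_integral {n : ℕ} (μ : Measure (Lat n)) [IsProbabilityMeasure μ]
    (x : Lat n) : (μ.real {x} : ℂ) = ∫ t, ft μ t * chi (-x) t ∂(torusHaar n) := by
  have hmeas : Measurable fun z : Lat n × Torus n => chi z.1 z.2 * chi (-x) z.2 :=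
    measurable_from_prod_countable_right fun y =>
      ((continuous_chi y).mul (continuous_chi (-x))).measurable
  have hint : Integrable (fun z : Lat n × Torus n => chi z.1 z.2 * chi (-x) z.2)
      (μ.prod (torusHaar n)) :=
    Integrable.of_bound hmeas.aestronglyMeasurable 1 (Filter.Eventually.of_forall fun z => by
      rw [norm_mul, norm_chi, norm_chi, one_mul])
  have h := integral_integral_swap (f := fun y t => chi y t * chi (-x) t) hint
  simp_rw [integral_mul_const] at h
  refine Eq.trans ?_ h
  simp_rw [← chi_add_left, integral_chi]
  have h1 : ∀ y : Lat n, (if y + -x = 0 then (1 : ℂ) else 0) =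
      Set.indicator {x} (fun _ => (1 : ℂ)) y := by
    intro y
    simp [Set.indicator_apply, ← sub_eq_add_neg, sub_eq_zero]
  simp_rw [h1]
  rw [integral_indicator_const _ (measurableSet_singleton x)]
  simp

theorem pairing_zsmul_left {n : ℕ} (p : ℤ) (v : Lat n) (t : Torus n) :
    pairing (p • v) t = p • pairing v t := by
  simp only [pairing, Finset.smul_sum]
  exact Finset.sum_congr rfl fun i _ => by rw [smul_smul]; rfl

theorem chi_zsmul_left {n : ℕ} (p : ℤ) (v : Lat n) (t : Torus n) :
    chi (p • v) t = fourier p (pairing v t) := by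
  rw [chi_eq_toCircle, pairing_zsmul_left, fourier_apply]

/-- If `μ̂` is small wherever `⟨v, t⟩` is not close to `0`, then the difference `μ - τ_v μ` is
pointwise close to the combination of translates with the weights of the kernel. -/
theorem abs_sub_tsum_le {n : ℕ} {μ : Measure (Lat n)} [IsProbabilityMeasure μ] {a η : ℝ}
    (hη : 0 ≤ η) {w : ℤ → ℝ} (hw : Summable fun p => |w p|)
    (hker : ∀ θ : UnitAddCircle, ‖θ‖ ≤ a → ∑' p : ℤ, (w p : ℂ) * fourier p θ = 1 - fourier 1 θ)
    {v : Lat n} (hv : ∀ t, a < ‖pairing v t‖ → ‖ft μ t‖ ≤ η) (x : Lat n) :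
    |μ.real {x} - μ.real {x - v} - ∑' p : ℤ, w p * μ.real {x - p • v}| ≤
      η * (2 + ∑' p, |w p|) := by
  have hcont := continuous_ft μ
  have hshift : ∀ p : ℤ, (μ.real {x - p • v} : ℂ) =
      ∫ t, ft μ t * chi (-x) t * fourier p (pairing v t) ∂(torusHaar n) := by
    intro p
    rw [measureReal_singleton_eq_integral]
    refine integral_congr_ae (Filter.Eventually.of_forall fun t => ?_)
    dsimp only
    rw [show -(x - p • v) = -x + p • v by abel, chi_add_left, chi_zsmul_left, mul_assoc]
  have hfb : ∀ (p : ℤ) (θ : UnitAddCircle), ‖(fourier p θ : ℂ)‖ = 1 := fun p θ => by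
    rw [fourier_apply, Circle.norm_coe]
  have hGb : ∀ t, ‖ft μ t * chi (-x) t‖ ≤ 1 := fun t => by
    rw [norm_mul, norm_chi, mul_one]; exact norm_ft_le_one μ t
  have hpc : Continuous fun t : Torus n => pairing v t := by unfold pairing; fun_prop
  have hI : ∀ p : ℤ, Integrable (fun t => ft μ t * chi (-x) t * fourier p (pairing v t))
      (torusHaar n) := by
    intro p
    refine Integrable.of_bound (Continuous.aestronglyMeasurable ?_) 1
      (Filter.Eventually.of_forall fun t => ?_)
    · exact (hcont.mul (continuous_chi _)).mul ((fourier p).continuous.comp hpc)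
    · rw [norm_mul, hfb, mul_one]; exact hGb t
  have hterm : ∀ t : Torus n, Summable fun p : ℤ => ‖(w p : ℂ) * fourier p (pairing v t)‖ := by
    intro t
    refine hw.congr fun p => ?_
    rw [norm_mul, hfb, mul_one, Complex.norm_real, Real.norm_eq_abs]
  have hT : ((∑' p : ℤ, w p * μ.real {x - p • v} : ℝ) : ℂ) =
      ∫ t, ft μ t * chi (-x) t * ∑' p : ℤ, (w p : ℂ) * fourier p (pairing v t)
        ∂(torusHaar n) := by
    have h1 := integral_tsum_of_summable_integral_norm (μ := torusHaar n)
      (F := fun (p : ℤ) t => (w p : ℂ) * (ft μ t * chi (-x) t * fourier p (pairing v t)))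
      (fun p => (hI p).const_mul _) ?_
    · simp_rw [integral_const_mul, ← hshift] at h1
      rw [Complex.ofReal_tsum]
      push_cast
      rw [h1]
      refine integral_congr_ae (Filter.Eventually.of_forall fun t => ?_)
      dsimp only
      rw [← tsum_mul_left]
      exact tsum_congr fun p => by ring
    · refine Summable.of_nonneg_of_le (fun p => integral_nonneg fun t => norm_nonneg _)
        (fun p => ?_) hw
      calc ∫ t, ‖(w p : ℂ) * (ft μ t * chi (-x) t * fourier p (pairing v t))‖ ∂(torusHaar n)
          ≤ ∫ t, |w p| ∂(torusHaar n) := by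
            refine integral_mono ((hI p).const_mul _).norm (integrable_const _) fun t => ?_
            dsimp only
            rw [norm_mul, norm_mul _ (fourier p (pairing v t)), hfb, mul_one, Complex.norm_real,
              Real.norm_eq_abs]
            exact mul_le_of_le_one_right (abs_nonneg _) (hGb t)
        _ = |w p| := by simp
  have hIT : Integrable (fun t => ft μ t * chi (-x) t * ∑' p : ℤ, (w p : ℂ) *
      fourier p (pairing v t)) (torusHaar n) := by
    refine Integrable.of_bound (Continuous.aestronglyMeasurable ?_) (∑' p, |w p|)
      (Filter.Eventually.of_forall fun t => ?_)
    · refine (hcont.mul (continuous_chi _)).mul (continuous_tsum (u := fun p => |w p|)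
        (fun p => continuous_const.mul ((fourier p).continuous.comp hpc)) hw fun p t => ?_)
      rw [norm_mul, hfb, mul_one, Complex.norm_real, Real.norm_eq_abs]
    · rw [norm_mul]
      refine (mul_le_of_le_one_left (norm_nonneg _) (hGb t)).trans ?_
      refine (norm_tsum_le_tsum_norm (hterm t)).trans (le_of_eq ?_)
      refine tsum_congr fun p => ?_
      rw [norm_mul, hfb, mul_one, Complex.norm_real, Real.norm_eq_abs]
  have h0 := hshift 0
  have h1 := hshift 1
  rw [zero_smul, sub_zero] at h0
  rw [one_smul] at h1
  have hmain : ((μ.real {x} - μ.real {x - v} - ∑' p : ℤ, w p * μ.real {x - p • v} : ℝ) : ℂ) =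
      ∫ t, ft μ t * chi (-x) t * (1 - fourier 1 (pairing v t) -
        ∑' p : ℤ, (w p : ℂ) * fourier p (pairing v t)) ∂(torusHaar n) := by
    have hI01 : Integrable (fun t => ft μ t * chi (-x) t * fourier 0 (pairing v t) -
        ft μ t * chi (-x) t * fourier 1 (pairing v t)) (torusHaar n) := (hI 0).sub (hI 1)
    rw [Complex.ofReal_sub, Complex.ofReal_sub, h0, h1, hT, ← integral_sub (hI 0) (hI 1),
      ← integral_sub hI01 hIT]
    refine integral_congr_ae (Filter.Eventually.of_forall fun t => ?_)
    dsimp only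
    rw [fourier_zero]
    ring
  rw [← Real.norm_eq_abs, ← Complex.norm_real, hmain]
  have hW : 0 ≤ ∑' p, |w p| := tsum_nonneg fun _ => abs_nonneg _
  have hfin := norm_integral_le_of_norm_le_const (μ := torusHaar n) (C := η * (2 + ∑' p, |w p|))
    (f := fun t => ft μ t * chi (-x) t * (1 - fourier 1 (pairing v t) -
        ∑' p : ℤ, (w p : ℂ) * fourier p (pairing v t))) (Filter.Eventually.of_forall fun t => ?_)
  · simpa using hfin
  · by_cases ht : ‖pairing v t‖ ≤ a
    · rw [hker _ ht, sub_self, mul_zero, norm_zero]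
      positivity
    · rw [norm_mul, norm_mul, norm_chi, mul_one]
      refine mul_le_mul (hv t (not_le.1 ht)) ?_ (norm_nonneg _) hη
      refine (norm_sub_le _ _).trans (add_le_add ((norm_sub_le _ _).trans ?_) ?_)
      · rw [norm_one, hfb]; norm_num
      · refine (norm_tsum_le_tsum_norm (hterm t)).trans (le_of_eq ?_)
        refine tsum_congr fun p => ?_
        rw [norm_mul, hfb, mul_one, Complex.norm_real, Real.norm_eq_abs]

theorem translate_real_singleton {n : ℕ} (v x : Lat n) (μ : Measure (Lat n)) :
    (translate v μ).real {x} = μ.real {x - v} := by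
  rw [translate, map_measureReal_apply Measurable.of_discrete (measurableSet_singleton x)]
  congr 1
  ext y
  exact eq_sub_iff_add_eq.symm

/-- The translates of `f` by multiples of `v` with weights `|w p|` have total mass `‖w‖₁ ‖f‖₁`. -/
theorem summable_weighted_translates {G : Type*} [AddCommGroup G] {f : G → ℝ} (hf0 : ∀ x, 0 ≤ f x)
    (hf : Summable f) {w : ℤ → ℝ} (hw : Summable fun p => |w p|) (v : G) :
    (∀ x, Summable fun p : ℤ => |w p| * f (x - p • v)) ∧
      HasSum (fun x => ∑' p : ℤ, |w p| * f (x - p • v)) ((∑' p, |w p|) * ∑' x, f x) := by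
  have hshift : ∀ u : G, HasSum (fun x => f (x - u)) (∑' x, f x) := fun u =>
    (Equiv.subRight u).hasSum_iff.2 hf.hasSum
  have hprod : Summable fun z : ℤ × G => |w z.1| * f (z.2 - z.1 • v) := by
    have h0 : 0 ≤ fun z : ℤ × G => |w z.1| * f (z.2 - z.1 • v) :=
      fun z => mul_nonneg (abs_nonneg _) (hf0 _)
    rw [summable_prod_of_nonneg h0]
    refine ⟨fun p => (hshift (p • v)).summable.mul_left |w p|, ?_⟩
    have h1 : ∀ p : ℤ, ∑' x, |w p| * f (x - p • v) = |w p| * ∑' x, f x := fun p => by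
      rw [tsum_mul_left, (hshift _).tsum_eq]
    simp only [h1]
    exact hw.mul_right _
  have hprod' : Summable fun z : G × ℤ => |w z.2| * f (z.1 - z.2 • v) := hprod.prod_symm
  refine ⟨fun x => hprod'.prod_factor x, ?_⟩
  have h2 : Summable fun x => ∑' p : ℤ, |w p| * f (x - p • v) := hprod'.prod
  have h3 : ∑' x, ∑' p : ℤ, |w p| * f (x - p • v) = (∑' p, |w p|) * ∑' x, f x := by
    rw [Summable.tsum_comm (f := fun (p : ℤ) (x : G) => |w p| * f (x - p • v)) hprod,
      ← tsum_mul_right]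
    exact tsum_congr fun p => by rw [tsum_mul_left, (hshift _).tsum_eq]
  rw [← h3]
  exact h2.hasSum

/-- The three terms are the mass of the weighted translates, the pointwise error summed over the
box `[-N, N]ⁿ`, and the mass of `μ` and `τ_v μ` outside that box. -/
theorem dTV_translate_le {n : ℕ} {μ : Measure (Lat n)} [IsProbabilityMeasure μ] {a η τ N' : ℝ}
    (hη : 0 ≤ η) {w : ℤ → ℝ} (hw : Summable fun p => |w p|)
    (hker : ∀ θ : UnitAddCircle, ‖θ‖ ≤ a → ∑' p : ℤ, (w p : ℂ) * fourier p θ = 1 - fourier 1 θ)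
    {v : Lat n} (hv : ∀ t, a < ‖pairing v t‖ → ‖ft μ t‖ ≤ η)
    (htail : μ.real {x | N' < ‖x‖} ≤ τ) {N : ℕ} (hN : N' + ‖v‖ ≤ N) :
    dTV μ (translate v μ) ≤ (1 / 2) * (∑' p, |w p| +
      (2 * N + 1) ^ n * (η * (2 + ∑' p, |w p|)) + 2 * τ) := by
  classical
  set W := ∑' p, |w p| with hW
  have hsm := summable_measureReal_singleton μ
  have htot : ∑' x, μ.real {x} = 1 := by
    have h := measureReal_eq_tsum_indicator μ Set.univ
    simpa using h.symm
  set Q : Finset (Lat n) := Finset.Icc (fun _ => -(N : ℤ)) (fun _ => (N : ℤ)) with hQ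
  have hQcard : (Q.card : ℝ) = (2 * N + 1) ^ n := by
    rw [hQ, Pi.card_Icc]
    simp only [Int.card_Icc, Finset.prod_const, Finset.card_univ, Fintype.card_fin]
    rw [show ((N : ℤ) + 1 - -(N : ℤ)).toNat = 2 * N + 1 by omega]
    push_cast
    rfl
  have hQmem : ∀ x : Lat n, x ∉ Q → (N : ℝ) < ‖x‖ := by
    intro x hx
    by_contra! hcon
    refine hx (Finset.mem_Icc.2 ⟨fun i => ?_, fun i => ?_⟩)
    all_goals
      have h1 := (norm_le_pi_norm x i).trans hcon
      rw [Int.norm_eq_abs] at h1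
      have h2 : |x i| ≤ (N : ℤ) := by exact_mod_cast h1
      have := abs_le.1 h2
      dsimp only
      omega
  obtain ⟨hAp, hAsum⟩ := summable_weighted_translates
    (fun x => (measureReal_nonneg : 0 ≤ μ.real {x})) hsm hw v
  rw [htot, mul_one, ← hW] at hAsum
  set A : Lat n → ℝ := fun x => ∑' p : ℤ, |w p| * μ.real {x - p • v} with hA
  set E := η * (2 + W) with hE
  set b1 : Lat n → ℝ := fun x => if x ∈ Q then E else 0 with hb1
  set s1 : Set (Lat n) := {x | N' < ‖x‖} with hs1
  set b2 : Lat n → ℝ := s1.indicator fun x => μ.real {x} with hb2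
  have hb2s : Summable b2 := hsm.indicator _
  have hb3s : Summable fun x => b2 (x - v) := (Equiv.subRight v).summable_iff.2 hb2s
  have hb1s : HasSum b1 (∑ x ∈ Q, E) := by
    have h : HasSum b1 (∑ x ∈ Q, b1 x) := hasSum_sum_of_ne_finset_zero fun x hx => if_neg hx
    rwa [Finset.sum_congr rfl fun x hx => if_pos hx] at h
  have hb20 : ∀ x, 0 ≤ b2 x := fun x => Set.indicator_nonneg (fun _ _ => measureReal_nonneg) x
  have hpt : ∀ x, |μ.real {x} - μ.real {x - v}| ≤ A x + b1 x + b2 x + b2 (x - v) := by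
    intro x
    have hA0 : 0 ≤ A x := tsum_nonneg fun p => mul_nonneg (abs_nonneg _) measureReal_nonneg
    by_cases hx : x ∈ Q
    · have h1 := abs_sub_tsum_le hη hw hker hv x
      have h2 : |∑' p : ℤ, w p * μ.real {x - p • v}| ≤ A x := by
        have h3 : ∀ p : ℤ, ‖w p * μ.real {x - p • v}‖ = |w p| * μ.real {x - p • v} := fun p => by
          rw [Real.norm_eq_abs, abs_mul,
            abs_of_nonneg (measureReal_nonneg : 0 ≤ μ.real {x - p • v})]
        have h4 := norm_tsum_le_tsum_norm (f := fun p : ℤ => w p * μ.real {x - p • v})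
          ((hAp x).congr fun p => (h3 p).symm)
        simp_rw [h3] at h4
        exact h4
      have h5 : b1 x = E := if_pos hx
      have h6 := abs_sub_abs_le_abs_sub (μ.real {x} - μ.real {x - v})
        (∑' p : ℤ, w p * μ.real {x - p • v})
      linarith [hb20 x, hb20 (x - v)]
    · have h1 := hQmem x hx
      have hv0 := norm_nonneg v
      have h2 : b2 x = μ.real {x} :=
        Set.indicator_of_mem (s := s1) (a := x) (by rw [hs1]; exact (by linarith : N' < ‖x‖)) _
      have h3 : b2 (x - v) = μ.real {x - v} :=
        Set.indicator_of_mem (s := s1) (a := x - v)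
          (by rw [hs1]; exact (by linarith [norm_sub_norm_le x v] : N' < ‖x - v‖)) _
      have h4 : b1 x = 0 := if_neg hx
      rw [h2, h3, h4]
      have h5 := abs_sub (μ.real {x}) (μ.real {x - v})
      rw [abs_of_nonneg (measureReal_nonneg : 0 ≤ μ.real {x}),
        abs_of_nonneg (measureReal_nonneg : 0 ≤ μ.real {x - v})] at h5
      linarith
  have hb2sum : ∑' x, b2 x ≤ τ := by
    rw [hb2, ← measureReal_eq_tsum_indicator]; exact htail
  have hb3sum : ∑' x, b2 (x - v) ≤ τ := by
    rw [show ∑' x, b2 (x - v) = ∑' x, b2 x from (Equiv.subRight v).tsum_eq b2]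
    exact hb2sum
  have hsumR := ((hAsum.summable.add hb1s.summable).add hb2s).add hb3s
  have hle := Summable.tsum_le_tsum hpt
    (Summable.of_nonneg_of_le (fun x => abs_nonneg _) hpt hsumR) hsumR
  rw [((hAsum.summable.add hb1s.summable).add hb2s).tsum_add hb3s,
    (hAsum.summable.add hb1s.summable).tsum_add hb2s, hAsum.summable.tsum_add hb1s.summable,
    hAsum.tsum_eq, hb1s.tsum_eq, Finset.sum_const, nsmul_eq_mul, hQcard] at hle
  rw [dTV]
  simp_rw [translate_real_singleton]
  linarith

/-! ### Convolutions of dense pieces of the discrete Gaussian -/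

theorem norm_pairing_le {n : ℕ} (v : Lat n) (t : Torus n) :
    ‖pairing v t‖ ≤ n * l2norm v * ‖t‖ := by
  have h : ∀ i, ‖v i • t i‖ ≤ l2norm v * ‖t‖ := fun i => by
    refine (norm_zsmul_le (v i) (t i)).trans ?_
    have h1 := (norm_le_pi_norm v i).trans (norm_le_l2norm v)
    have h2 := norm_le_pi_norm t i
    rw [Int.norm_eq_abs] at h1 ⊢
    exact mul_le_mul h1 h2 (norm_nonneg _) (norm_nonneg _)
  calc ‖pairing v t‖ ≤ ∑ i, ‖v i • t i‖ := norm_sum_le _ _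
    _ ≤ ∑ _i : Fin n, l2norm v * ‖t‖ := Finset.sum_le_sum fun i _ => h i
    _ = _ := by simp [mul_assoc]

theorem norm_ft_convolution_le {n M : ℕ} {μ : Fin M → Measure (Lat n)}
    (hμ : ∀ i, IsProbabilityMeasure (μ i)) {t : Torus n} {y : ℝ}
    (hy : y ≤ ∑ i, (1 - ‖ft (μ i) t‖ ^ 2)) : ‖ft (convolution μ) t‖ ≤ Real.exp (-y / 2) := by
  have h : ‖ft (convolution μ) t‖ ^ 2 ≤ Real.exp (-y / 2) ^ 2 := by
    rw [ft_convolution μ hμ, norm_prod, ← Finset.prod_pow, ← Real.exp_nat_mul]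
    calc ∏ i, ‖ft (μ i) t‖ ^ 2 ≤ ∏ i, Real.exp (-(1 - ‖ft (μ i) t‖ ^ 2)) := by
          refine Finset.prod_le_prod (fun i _ => by positivity) fun i _ => ?_
          have := Real.add_one_le_exp (-(1 - ‖ft (μ i) t‖ ^ 2))
          linarith
      _ = Real.exp (-∑ i, (1 - ‖ft (μ i) t‖ ^ 2)) := by
        rw [← Real.exp_sum, Finset.sum_neg_distrib]
      _ ≤ _ := Real.exp_le_exp.2 (by push_cast; linarith)
  exact (pow_le_pow_iff_left₀ (norm_nonneg _) (Real.exp_pos _).le two_ne_zero).1 h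

/-- As the densities are at most `1`, each of them is at least `α ^ M`. The resulting loss is
harmless, because the threshold `T` can be taken much larger than `R`. -/
theorem convolution_tail_of_densePiece {n M : ℕ} {α R T : ℝ} (hR : 0 < R) (hT : 0 ≤ T)
    {μ : Fin M → Measure (Lat n)} (hμ : ∀ i, IsProbabilityMeasure (μ i))
    {a : Fin M → ℝ} (ha : ∀ i, 0 < a i ∧ a i ≤ 1) (hα : 0 < α)
    (hprod : α ^ M ≤ ∏ i, a i) (hpiece : ∀ i, IsDensePiece (a i) (μ i) (discreteGaussian n R)) :
    (convolution μ).real {x | M * T < ‖x‖} ≤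
      M * ((α ^ M)⁻¹ * (2 ^ n * Real.exp (-Real.pi * T ^ 2 / (2 * R ^ 2)))) := by
  have := isProbabilityMeasure_discreteGaussian n hR
  refine convolution_tail_le μ hμ fun i => ?_
  refine ((hpiece i).measureReal_le _).trans ?_
  have h1 : α ^ M ≤ a i := by
    refine hprod.trans ?_
    rw [← Finset.mul_prod_erase _ _ (Finset.mem_univ i)]
    exact mul_le_of_le_one_right (ha i).1.le
      (Finset.prod_le_one (fun j _ => (ha j).1.le) fun j _ => (ha j).2)
  refine mul_le_mul (inv_anti₀ (by positivity) h1) (discreteGaussian_tail hR hT) measureReal_nonneg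
    (by positivity)

/-! ### Size conditions on the parameters -/

theorem eventually_const_mul_rpow_le (K : ℝ) {b c : ℝ} (h : b < c) :
    ∀ᶠ x : ℝ in Filter.atTop, K * x ^ b ≤ x ^ c := by
  have h1 := (tendsto_rpow_atTop (sub_pos.2 h)).eventually_ge_atTop K
  filter_upwards [h1, Filter.eventually_gt_atTop 0] with x hx hx0
  calc K * x ^ b ≤ x ^ (c - b) * x ^ b := by gcongr
    _ = x ^ c := by rw [← Real.rpow_add hx0]; congr 1; ring

/-- The conditions that `R` is large, in terms of the constants of the Gaussian decay estimate and
of the difference kernel. -/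
structure IsLarge (C C' x : ℝ) : Prop where
  log_le : Real.log x ≤ x ^ (1 / 100 : ℝ)
  h_sqrt : 8 * x ^ (3 / 100 : ℝ) ≤ x ^ (1 / 2 : ℝ)
  h_decay : C ≤ x ^ (1 / 2 : ℝ)
  h_defect : 256 * x ^ (6 / 100 : ℝ) ≤ x ^ (4 / 5 : ℝ)
  h_kernel : 2 * C' * x ^ (1 / 50 : ℝ) ≤ x ^ (1 / 15 : ℝ)
  h_box : 28 * x ^ (3 / 100 : ℝ) ≤ x
  h_lin : 64 * (2 + C') ≤ x

theorem eventually_isLarge (C C' : ℝ) : ∀ᶠ x : ℝ in Filter.atTop, IsLarge C C' x := by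
  have h1 : ∀ᶠ x : ℝ in Filter.atTop, Real.log x ≤ x ^ (1 / 100 : ℝ) := by
    have h := (isLittleO_log_rpow_atTop (r := 1 / 100) (by norm_num)).bound one_pos
    filter_upwards [h, Filter.eventually_ge_atTop 1] with x hx hx1
    rw [one_mul, Real.norm_eq_abs, Real.norm_eq_abs, abs_of_nonneg (Real.log_nonneg hx1),
      abs_of_nonneg (by positivity)] at hx
    exact hx
  filter_upwards [h1, eventually_const_mul_rpow_le 8 (by norm_num : (3 / 100 : ℝ) < 1 / 2),
    eventually_const_mul_rpow_le C (by norm_num : (0 : ℝ) < 1 / 2),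
    eventually_const_mul_rpow_le 256 (by norm_num : (6 / 100 : ℝ) < 4 / 5),
    eventually_const_mul_rpow_le (2 * C') (by norm_num : (1 / 50 : ℝ) < 1 / 15),
    eventually_const_mul_rpow_le 28 (by norm_num : (3 / 100 : ℝ) < 1),
    Filter.eventually_ge_atTop (64 * (2 + C'))] with x h1 h2 h3 h4 h5 h6 h7
  rw [Real.rpow_zero, mul_one] at h3
  rw [Real.rpow_one] at h6
  exact ⟨h1, h2, h3, h4, h5, h6, h7⟩

/-- Elementary consequences of the hypotheses relating `n`, `R`, `α` and `S`. -/
structure Params (n : ℕ) (x α S : ℝ) : Prop where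
  n_le : (n : ℝ) ≤ x ^ (1 / 50 : ℝ)
  n_log_le : n * Real.log x ≤ x ^ (3 / 100 : ℝ)
  one_le_S : 1 ≤ S
  S_log_le : S * Real.log 2 ≤ n * Real.log x
  α_eq : α = 2 * Real.exp (-(S * Real.log 2))

theorem params_of_isLarge {C C' : ℝ} {n R : ℕ} {α S : ℝ} (hL : IsLarge C C' R) (hC' : 0 < C')
    (hn : n ^ 50 ≤ R) (hα : 0 < α) (hα1 : α ≤ 1) (hS : S = Real.logb 2 (2 / α))
    (hSn : S ≤ n * Real.logb 2 R) : Params n R α S := by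
  have hx1 : (128 : ℝ) ≤ R := by linarith [hL.h_lin]
  have hlog2 := Real.log_pos one_lt_two
  have hn1 : (n : ℝ) ≤ (R : ℝ) ^ (1 / 50 : ℝ) := by
    have h : ((n : ℝ) ^ (50 : ℕ)) ≤ R := by exact_mod_cast hn
    calc (n : ℝ) = ((n : ℝ) ^ (50 : ℕ)) ^ (1 / 50 : ℝ) := by
          rw [← Real.rpow_natCast, ← Real.rpow_mul (by positivity)]; norm_num
      _ ≤ _ := by gcongr
  refine ⟨hn1, ?_, ?_, ?_, ?_⟩
  · calc n * Real.log R ≤ (R : ℝ) ^ (1 / 50 : ℝ) * (R : ℝ) ^ (1 / 100 : ℝ) :=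
          mul_le_mul hn1 hL.log_le (Real.log_nonneg (by linarith)) (by positivity)
      _ = _ := by rw [← Real.rpow_add (by linarith)]; norm_num
  · rw [hS, Real.le_logb_iff_rpow_le one_lt_two (by positivity), Real.rpow_one,
      le_div_iff₀ hα]
    linarith
  · rw [Real.logb, ← mul_div_assoc, le_div_iff₀ hlog2] at hSn
    exact hSn
  · have h1 : S * Real.log 2 = Real.log (2 / α) := by
      rw [hS, Real.logb, div_mul_cancel₀ _ hlog2.ne']
    rw [h1, Real.exp_neg, Real.exp_log (by positivity)]
    field_simp

theorem Params.le_two_mul_rpow {n : ℕ} {x α S : ℝ} (hP : Params n x α S) :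
    S ≤ 2 * x ^ (3 / 100 : ℝ) := by
  have h := hP.S_log_le.trans hP.n_log_le
  have hlog2 := Real.log_two_gt_d9
  have hS1 := hP.one_le_S
  nlinarith

/-- At distance `R^(-3/4)` from the origin the transform of the discrete Gaussian is smaller than
the reciprocal of the number of subset sums. -/
theorem two_pow_mul_decay_le {C C' : ℝ} {n R B : ℕ} {α S : ℝ} (hL : IsLarge C C' R)
    (hP : Params n R α S) (hx0 : (0 : ℝ) < R) (hC : 0 < C) (hB2 : (B : ℝ) ≤ 2 * S + 1) :
    2 ^ (B + 1) * (C * Real.exp (-Real.pi * (R : ℝ) ^ 2 * ((R : ℝ) ^ (-(3 / 4) : ℝ)) ^ 2 / 2)) ≤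
      1 := by
  have hS1 := hP.one_le_S
  have hlog2 := Real.log_pos one_lt_two
  have hSz : S * Real.log 2 ≤ (R : ℝ) ^ (3 / 100 : ℝ) := hP.S_log_le.trans hP.n_log_le
  set r := (R : ℝ) ^ (-(3 / 4) : ℝ) with hr
  set ε := C * Real.exp (-Real.pi * (R : ℝ) ^ 2 * r ^ 2 / 2) with hε
  set q := (R : ℝ) ^ (1 / 2 : ℝ) with hq
  have hq0 : 0 < q := Real.rpow_pos_of_pos hx0 _
  have e1 : (R : ℝ) ^ 2 * r ^ 2 = q := by
    rw [hr, hq, ← Real.rpow_natCast, ← Real.rpow_natCast, ← Real.rpow_mul hx0.le,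
      ← Real.rpow_add hx0]
    norm_num
  have e2 : (2 : ℝ) ^ (B + 1) = Real.exp ((B + 1 : ℕ) * Real.log 2) := by
    rw [Real.exp_nat_mul, Real.exp_log two_pos]
  have e3 : ((B + 1 : ℕ) : ℝ) * Real.log 2 ≤ q / 2 := by
    have h1 : ((B + 1 : ℕ) : ℝ) ≤ 4 * S := by push_cast; linarith
    have h2 := mul_le_mul_of_nonneg_right h1 hlog2.le
    have h3 := hL.h_sqrt
    linarith
  have e4 : C ≤ Real.exp q := hL.h_decay.trans (by linarith [Real.add_one_le_exp q])
  have hpi := Real.pi_gt_three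
  calc 2 ^ (B + 1) * ε ≤ Real.exp (q / 2) * (Real.exp q * Real.exp (-(3 / 2) * q)) := by
        rw [e2, hε]
        gcongr
        rw [mul_assoc, e1]
        nlinarith
    _ = 1 := by
      rw [← Real.exp_add, ← Real.exp_add, ← Real.exp_zero]
      congr 1; ring

/-- Subset sums of `B + 1` frequencies of defect at most `M R^(-4/5)` have defect at most `M / 4`.
-/
theorem sq_mul_rpow_le {C C' : ℝ} {n R B : ℕ} {α S : ℝ} (hL : IsLarge C C' R)
    (hP : Params n R α S) (hx0 : (0 : ℝ) < R) (hB2 : (B : ℝ) ≤ 2 * S + 1) :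
    ((B : ℝ) + 1) ^ 2 * (R : ℝ) ^ (-(4 / 5) : ℝ) ≤ 1 / 4 := by
  have hS1 := hP.one_le_S
  have hSz2 := hP.le_two_mul_rpow
  have h1 : ((B : ℝ) + 1) ^ 2 ≤ (8 * (R : ℝ) ^ (3 / 100 : ℝ)) ^ 2 := by
    gcongr; linarith
  have h2 : (8 * (R : ℝ) ^ (3 / 100 : ℝ)) ^ 2 = 64 * (R : ℝ) ^ (6 / 100 : ℝ) := by
    rw [mul_pow, ← Real.rpow_natCast ((R : ℝ) ^ (3 / 100 : ℝ)) 2, ← Real.rpow_mul hx0.le]; norm_num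
  have h3 := hL.h_defect
  rw [Real.rpow_neg hx0.le, ← div_eq_mul_inv, div_le_iff₀ (by positivity)]
  linarith

/-- If `B` exceeds `2 S`, the number `2^(B + 1)` of subset sums exceeds the packing bound
`8 / α²`, as `α = 2^(1 - S)`. -/
theorem eight_lt_two_pow_mul_sq {n B : ℕ} {x α S : ℝ} (hP : Params n x α S) (hα : 0 < α)
    (hB1 : 2 * S < B) : 8 < 2 ^ (B + 1) * α ^ 2 := by
  have hlog2 := Real.log_pos one_lt_two
  have h1 : Real.exp (2 * S * Real.log 2) < 2 ^ B := by
    have : (2 : ℝ) ^ B = Real.exp (B * Real.log 2) := by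
      rw [Real.exp_nat_mul, Real.exp_log two_pos]
    rw [this]
    exact Real.exp_lt_exp.2 (by gcongr)
  have h2 : α ^ 2 * Real.exp (2 * S * Real.log 2) = 4 := by
    rw [hP.α_eq, mul_pow, ← Real.exp_nat_mul, mul_assoc, ← Real.exp_add]
    push_cast
    rw [show 2 * -(S * Real.log 2) + 2 * S * Real.log 2 = 0 by ring, Real.exp_zero]
    norm_num
  have h3 := mul_lt_mul_of_pos_left h1 (by positivity : 0 < α ^ 2)
  rw [pow_succ]
  linarith

/-- The bound on the order of the group, in terms of `y = 1000 (1 + S / log R)` and `D = ⌈y⌉`. -/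
theorem two_mul_pow_pow_le {D B : ℕ} {y s : ℝ} (hy : 1000 ≤ y) (hDy : (D : ℝ) ≤ 2 * y)
    (hs : 12 * B ≤ s) : (2 * (D : ℝ) ^ 10) ^ B ≤ y ^ s := by
  have h : 2 * (D : ℝ) ^ 10 ≤ y ^ 12 := by
    calc 2 * (D : ℝ) ^ 10 ≤ 2 * (2 * y) ^ 10 := by gcongr
      _ = y ^ 10 * 2048 := by ring
      _ ≤ y ^ 10 * y ^ 2 := by gcongr; nlinarith
      _ = _ := by ring
  calc (2 * (D : ℝ) ^ 10) ^ B ≤ (y ^ 12) ^ B := by gcongr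
    _ = y ^ ((12 * B : ℕ) : ℝ) := by rw [← pow_mul, Real.rpow_natCast]
    _ ≤ y ^ s := by
      refine Real.rpow_le_rpow_of_exponent_le (by linarith) ?_
      push_cast
      exact hs

/-- The accumulated rounding error: as `D` is at least `1000 S / log R`, the growth factor
`(1 + 4 / D)^B` is at most `R^(1/50)`. -/
theorem rpow_mul_pow_le {D B : ℕ} {x S : ℝ} (hx1 : 1 < x) (hS1 : 1 ≤ S)
    (hB2 : (B : ℝ) ≤ 2 * S + 1) (hDy : 1000 * (1 + S / Real.logb 2 x) ≤ D) :
    x ^ (-(3 / 4) : ℝ) * (1 + 4 / (D : ℝ)) ^ B ≤ x ^ (-(73 / 100) : ℝ) := by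
  have hlog2 := Real.log_pos one_lt_two
  have hlog2' := Real.log_two_gt_d9
  have hlogx : 0 < Real.log x := Real.log_pos hx1
  set L := Real.logb 2 x with hLdef
  have hL0 : 0 < L := div_pos hlogx hlog2
  have hLlog : L * Real.log 2 = Real.log x := by rw [hLdef, Real.logb, div_mul_cancel₀ _ hlog2.ne']
  have hSL : 0 < S / L := by positivity
  have hD0 : (0 : ℝ) < D := by linarith
  have h1 : (1 + 4 / (D : ℝ)) ^ B ≤ Real.exp (B * (4 / D)) := by
    rw [Real.exp_nat_mul]
    gcongr
    linarith [Real.add_one_le_exp (4 / (D : ℝ))]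
  have h2 : (B : ℝ) * (4 / D) ≤ Real.log x * (2 / 100) := by
    have h3 : S ≤ L * (1 + S / L) := by
      rw [mul_add, mul_div_cancel₀ _ hL0.ne']; linarith
    have h4 : 1000 * S ≤ L * D := by
      have := mul_le_mul_of_nonneg_left hDy hL0.le
      linarith
    rw [← mul_div_assoc, div_le_iff₀ hD0, ← hLlog]
    have h5 : L * D * (69 / 100) ≤ L * D * Real.log 2 := by gcongr; linarith
    linarith
  calc x ^ (-(3 / 4) : ℝ) * (1 + 4 / (D : ℝ)) ^ B
      ≤ x ^ (-(3 / 4) : ℝ) * Real.exp (Real.log x * (2 / 100)) := by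
        gcongr
        exact h1.trans (Real.exp_le_exp.2 h2)
    _ = _ := by
      rw [← Real.rpow_def_of_pos (by linarith), ← Real.rpow_add (by linarith)]
      norm_num

/-! ### Frequencies of small defect lie near a small finite group -/

/-- The structural half: the frequencies of total defect at most `R` lie near a finite group with
few generators and controlled order. -/
theorem exists_generators_of_pieces {C C' : ℝ} (hC : 0 < C) (hC' : 0 < C') {n R : ℕ} {α S : ℝ}
    (hdecay : ∀ (t : Torus n) (r : ℝ), 0 < r → r ≤ ‖t‖ →
      ‖ft (discreteGaussian n R) t‖ ≤ C * Real.exp (-Real.pi * (R : ℝ) ^ 2 * r ^ 2 / 2))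
    (hL : IsLarge C C' R) (hP : Params n R α S) (hα : 0 < α) (hα1 : α ≤ 1)
    {a : Fin (R ^ 2) → ℝ} (ha : ∀ i, 0 < a i ∧ a i ≤ 1) (hprod : α ^ (R ^ 2) ≤ ∏ i, a i)
    {μ : Fin (R ^ 2) → Measure (Lat n)} (hμ : ∀ i, IsProbabilityMeasure (μ i))
    (hpiece : ∀ i, IsDensePiece (a i) (μ i) (discreteGaussian n R)) :
    ∃ (m : ℕ) (t : ℕ → Torus n) (k : ℕ → ℕ), (m : ℝ) ≤ 14 * S ∧ (∀ j < m, 1 ≤ k j) ∧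
      ((∏ j ∈ Finset.range m, k j : ℕ) : ℝ) ≤
        (1000 * (1 + S / Real.logb 2 R)) ^ (672 * S) ∧
      (∀ j < m, ∃ c : ℕ → ℕ, (∀ i < j, c i < k i) ∧
        k j • t j = ∑ i ∈ Finset.range j, c i • t i) ∧
      ∀ x : Torus n, ∑ i, (1 - ‖ft (μ i) x‖ ^ 2) ≤ (R : ℝ) → ∃ b : ℕ → ℤ,
        ‖x - ∑ i ∈ Finset.range m, b i • t i‖ ≤ (R : ℝ) ^ (-(73 / 100) : ℝ) := by
  have hx1 : (128 : ℝ) ≤ R := by linarith [hL.h_lin]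
  have hx0 : (0 : ℝ) < R := by linarith
  have hS1 := hP.one_le_S
  set L := Real.logb 2 R
  have hL0 : 0 < L := Real.logb_pos one_lt_two (by linarith)
  set y := 1000 * (1 + S / L) with hy
  have hSL : 0 < S / L := by positivity
  have hy1000 : 1000 ≤ y := by rw [hy]; linarith
  set D := ⌈y⌉₊ with hD
  have hDy : y ≤ D := Nat.le_ceil y
  have hDy2 : (D : ℝ) ≤ 2 * y := by
    have := Nat.ceil_lt_add_one (by linarith : 0 ≤ y)
    linarith
  have hD4 : 4 ≤ D := by
    have : (4 : ℝ) ≤ D := by linarith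
    exact_mod_cast this
  -- The run length `I` is the first exponent with `D ^ I` above `R ^ (1 / 10)`.
  have hexI : ∃ I : ℕ, (R : ℝ) ^ (1 / 10 : ℝ) < (D : ℝ) ^ I :=
    pow_unbounded_of_one_lt _ (by linarith)
  classical
  set I := Nat.find hexI with hI
  have hIspec : (R : ℝ) ^ (1 / 10 : ℝ) < (D : ℝ) ^ I := Nat.find_spec hexI
  have hImin : ∀ b < I, (D : ℝ) ^ b ≤ (R : ℝ) ^ (1 / 10 : ℝ) := fun b hb =>
    not_lt.1 (Nat.find_min hexI hb)
  have hI1 : 1 ≤ I := by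
    by_contra! h0
    have h0 : I = 0 := by omega
    rw [h0, pow_zero] at hIspec
    exact absurd hIspec (not_lt.2 (Real.one_le_rpow (by linarith) (by norm_num)))
  set r := (R : ℝ) ^ (-(3 / 4) : ℝ) with hr
  have hr0 : 0 < r := Real.rpow_pos_of_pos hx0 _
  -- The first integer above `2 S`, so that `2 ^ (B + 1)` exceeds the packing bound `8 / α²`.
  set B := ⌊2 * S⌋₊ + 1 with hB
  have hB1 : 2 * S < B := by rw [hB]; push_cast; exact Nat.lt_floor_add_one _
  have hB2 : (B : ℝ) ≤ 2 * S + 1 := by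
    have := Nat.floor_le (by linarith : 0 ≤ 2 * S)
    rw [hB]; push_cast; linarith
  have hfree : 1 ≤ 2 * r * (D : ℝ) ^ (9 * I) := by
    have h1 : (R : ℝ) ^ (9 / 10 : ℝ) ≤ (D : ℝ) ^ (9 * I) := by
      calc (R : ℝ) ^ (9 / 10 : ℝ) = ((R : ℝ) ^ (1 / 10 : ℝ)) ^ 9 := by
            rw [← Real.rpow_natCast, ← Real.rpow_mul hx0.le]; norm_num
        _ ≤ ((D : ℝ) ^ I) ^ 9 := by gcongr
        _ = _ := by rw [← pow_mul]; ring_nf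
    have h2 : 1 ≤ r * (R : ℝ) ^ (9 / 10 : ℝ) := by
      rw [hr, ← Real.rpow_add hx0]
      exact Real.one_le_rpow (by linarith) (by norm_num)
    have h3 := mul_le_mul_of_nonneg_left h1 hr0.le
    linarith
  have hεle := two_pow_mul_decay_le hL hP hx0 hC hB2
  have hδ := sq_mul_rpow_le hL hP hx0 hB2
  have hB8 := eight_lt_two_pow_mul_sq hP hα hB1
  set A : Set (Torus n) := {x | ∑ i, (1 - ‖ft (μ i) x‖ ^ 2) ≤ (R : ℝ)}
  have hcount : ∀ (m : ℕ) (l : ℕ → ℕ) (u : ℕ → Torus n), (∀ j < m, u j ∈ A) →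
      (∀ j < m, l j ≤ I) → Dissociated r D m l u → ∑ j ∈ Finset.range m, l j ≤ B := by
    intro m l u hu hl hdis
    have hγ := isProbabilityMeasure_discreteGaussian n hx0
    have hmem : ∀ p ∈ (Finset.range m).sigma fun j => Finset.range (l j),
        p.1 < m ∧ p.2 < l p.1 := by
      intro p hp
      simpa using hp
    have h := card_le_of_dissociated (M := R ^ 2) (pow_pos (by exact_mod_cast hx0) 2) hμ ha hα
      hα1 hprod hpiece hr0 (by positivity) (fun t ht => hdecay t r hr0 ht) hεle hδ hB8
      ((Finset.range m).sigma fun j => Finset.range (l j)) (fun p => (D ^ p.2) • u p.1) ?_ ?_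
    · rw [Finset.card_sigma] at h
      simpa using h
    · intro p hp
      obtain ⟨h1, h2⟩ := hmem p hp
      have h3 : ∑ i, (1 - ‖ft (μ i) (u p.1)‖ ^ 2) ≤ (R : ℝ) := hu p.1 h1
      have h4 := hImin p.2 (h2.trans_le (hl p.1 h1))
      calc ∑ i, (1 - ‖ft (μ i) ((D ^ p.2) • u p.1)‖ ^ 2)
          ≤ ∑ i, ((D ^ p.2 : ℕ) : ℝ) ^ 2 * (1 - ‖ft (μ i) (u p.1)‖ ^ 2) :=
            Finset.sum_le_sum fun i _ => defect_nsmul_le (μ i) _ _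
        _ = ((D : ℝ) ^ p.2) ^ 2 * ∑ i, (1 - ‖ft (μ i) (u p.1)‖ ^ 2) := by
          rw [← Finset.mul_sum]; push_cast; rfl
        _ ≤ ((D : ℝ) ^ p.2) ^ 2 * (R : ℝ) := by gcongr
        _ ≤ ((R : ℝ) ^ (1 / 10 : ℝ)) ^ 2 * (R : ℝ) := by gcongr
        _ = ((R ^ 2 : ℕ) : ℝ) * (R : ℝ) ^ (-(4 / 5) : ℝ) := by
          push_cast
          rw [← Real.rpow_natCast, ← Real.rpow_natCast, ← Real.rpow_mul hx0.le,
            ← Real.rpow_add_one hx0.ne', ← Real.rpow_add hx0]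
          norm_num
    · intro e he hlt p hp
      obtain ⟨h1, h2⟩ := hmem p hp
      refine hdis (fun j b => e ⟨j, b⟩) (fun j b => he _) ?_ p.1 h1 p.2 h2
      rwa [combo_eq_sum_sigma]
  obtain ⟨m, t, k, hm, hk1, hk, hrel, hcov⟩ := exists_generators exists_nsmul_eq_norm_le
    norm_torus_le_one hr0 hD4 hI1 hfree hcount
  have hmB : (m : ℝ) ≤ B := by exact_mod_cast hm
  refine ⟨m, t, k, by linarith, hk1, ?_, hrel, fun x hx => ?_⟩
  · refine le_trans (by exact_mod_cast hk) (two_mul_pow_pow_le hy1000 hDy2 ?_)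
    linarith
  · obtain ⟨b, hb⟩ := hcov x hx
    exact ⟨b, hb.trans (rpow_mul_pow_le (by linarith) hS1 hB2 hDy)⟩

/-! ### Almost invariance under translation -/

theorem kernel_bound_le {C C' : ℝ} {R : ℕ} (hL : IsLarge C C' R) (hx0 : (0 : ℝ) < R) :
    C' * ((R : ℝ) ^ (-(1 / 3) : ℝ)) ^ (1 / 5 : ℝ) ≤ (R : ℝ) ^ (-(1 / 50) : ℝ) / 2 := by
  set X := (R : ℝ) ^ (-(1 / 50) : ℝ) with hX
  have h1 : C' * ((R : ℝ) ^ (-(1 / 3) : ℝ)) ^ (1 / 5 : ℝ) = C' * (R : ℝ) ^ (-(1 / 15) : ℝ) := by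
    rw [← Real.rpow_mul hx0.le]; norm_num
  have h2 := mul_le_mul_of_nonneg_right hL.h_kernel
    (by positivity : 0 ≤ (R : ℝ) ^ (-(1 / 15) : ℝ) * X)
  have h3 : (R : ℝ) ^ (1 / 15 : ℝ) * (R : ℝ) ^ (-(1 / 15) : ℝ) = 1 := by
    rw [← Real.rpow_add hx0]; norm_num
  have h4 : (R : ℝ) ^ (1 / 50 : ℝ) * X = 1 := by
    rw [hX, ← Real.rpow_add hx0]; norm_num
  have h5 : 2 * C' * (R : ℝ) ^ (1 / 50 : ℝ) * ((R : ℝ) ^ (-(1 / 15) : ℝ) * X) =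
      2 * (C' * (R : ℝ) ^ (-(1 / 15) : ℝ)) := by
    linear_combination 2 * C' * (R : ℝ) ^ (-(1 / 15) : ℝ) * h4
  have h6 : (R : ℝ) ^ (1 / 15 : ℝ) * ((R : ℝ) ^ (-(1 / 15) : ℝ) * X) = X := by
    linear_combination X * h3
  rw [h1]
  linarith

theorem inv_le_rpow_neg {x : ℝ} (hx : 1 ≤ x) : x⁻¹ ≤ x ^ (-(1 / 50) : ℝ) := by
  rw [← Real.rpow_neg_one]
  exact Real.rpow_le_rpow_of_exponent_le hx (by norm_num)

/-- The factor `exp (-R / 2)` from the transform outweighs the number of points of the box. -/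
theorem box_term_le {C C' : ℝ} {n R : ℕ} {α S W : ℝ} (hL : IsLarge C C' R) (hP : Params n R α S)
    (hC' : 0 < C') (hWn : 0 ≤ W) (hWC : W ≤ C') :
    (2 * ((R ^ 6 + R : ℕ) : ℝ) + 1) ^ n * (Real.exp (-(R : ℝ) / 2) * (2 + W)) ≤
      (R : ℝ) ^ (-(1 / 50) : ℝ) / 2 := by
  have hx1 : (128 : ℝ) ≤ R := by linarith [hL.h_lin]
  have hx0 : (0 : ℝ) < R := by linarith
  have hbox := hL.h_box
  have hXR := inv_le_rpow_neg (by linarith : (1 : ℝ) ≤ R)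
  set X := (R : ℝ) ^ (-(1 / 50) : ℝ) with hX
  have h1 : 2 * ((R ^ 6 + R : ℕ) : ℝ) + 1 ≤ (R : ℝ) ^ 7 := by
    push_cast
    have e1 : (1 : ℝ) ≤ (R : ℝ) ^ 5 := one_le_pow₀ (by linarith)
    have e2 : (R : ℝ) ≤ (R : ℝ) ^ 6 := by
      calc (R : ℝ) = R * 1 := (mul_one _).symm
        _ ≤ R * (R : ℝ) ^ 5 := by gcongr
        _ = _ := by ring
    have e3 : (R : ℝ) ^ 7 = R * (R : ℝ) ^ 6 := by ring
    rw [e3]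
    nlinarith
  have h2 : (2 * ((R ^ 6 + R : ℕ) : ℝ) + 1) ^ n ≤ Real.exp (R / 4) := by
    calc (2 * ((R ^ 6 + R : ℕ) : ℝ) + 1) ^ n ≤ ((R : ℝ) ^ 7) ^ n := by gcongr
      _ = Real.exp (7 * (n * Real.log R)) := by
        rw [← pow_mul, show (7 : ℝ) * (n * Real.log R) = ((7 * n : ℕ) : ℝ) * Real.log R by
          push_cast; ring, Real.exp_nat_mul, Real.exp_log hx0]
      _ ≤ _ := Real.exp_le_exp.2 (by linarith [hP.n_log_le])
  have h3 : Real.exp (-(R : ℝ) / 4) ≤ 32 / (R : ℝ) ^ 2 := by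
    have := Real.quadratic_le_exp_of_nonneg (by positivity : 0 ≤ (R : ℝ) / 4)
    rw [neg_div, Real.exp_neg, inv_le_comm₀ (Real.exp_pos _) (by positivity), inv_div]
    nlinarith
  calc (2 * ((R ^ 6 + R : ℕ) : ℝ) + 1) ^ n * (Real.exp (-(R : ℝ) / 2) * (2 + W))
      ≤ Real.exp (R / 4) * (Real.exp (-(R : ℝ) / 2) * (2 + C')) := by gcongr
    _ = Real.exp (-(R : ℝ) / 4) * (2 + C') := by
      rw [← mul_assoc, ← Real.exp_add]; ring_nf
    _ ≤ 32 / (R : ℝ) ^ 2 * (2 + C') := by gcongr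
    _ ≤ (R : ℝ)⁻¹ / 2 := by
      have := hL.h_lin
      rw [div_mul_eq_mul_div, div_le_iff₀ (by positivity)]
      have e : (R : ℝ)⁻¹ / 2 * (R : ℝ) ^ 2 = R / 2 := by field_simp
      rw [e]
      linarith
    _ ≤ X / 2 := by linarith

/-- The Gaussian tail at radius `R ^ 4` outweighs the loss `α^(-M)` in passing to dense pieces. -/
theorem tail_term_le {C C' : ℝ} {n R : ℕ} {α S : ℝ} (hL : IsLarge C C' R) (hP : Params n R α S)
    (hx1 : (128 : ℝ) ≤ R) :
    ((R ^ 2 : ℕ) : ℝ) * ((α ^ (R ^ 2))⁻¹ *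
      (2 ^ n * Real.exp (-Real.pi * ((R : ℝ) ^ 4) ^ 2 / (2 * (R : ℝ) ^ 2)))) ≤
      (R : ℝ) ^ (-(1 / 50) : ℝ) / 2 := by
  have hx0 : (0 : ℝ) < R := by linarith
  have hlogx : 0 < Real.log R := Real.log_pos (by linarith)
  have hXR := inv_le_rpow_neg (by linarith : (1 : ℝ) ≤ R)
  have hz0 : (0 : ℝ) < (R : ℝ) ^ (3 / 100 : ℝ) := Real.rpow_pos_of_pos hx0 _
  have hSz : S * Real.log 2 ≤ (R : ℝ) ^ (3 / 100 : ℝ) := hP.S_log_le.trans hP.n_log_le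
  have hbox := hL.h_box
  set z := (R : ℝ) ^ (3 / 100 : ℝ) with hz
  set X := (R : ℝ) ^ (-(1 / 50) : ℝ) with hX
  have hlog2 := Real.log_pos one_lt_two
  have hzR : z ≤ R := by linarith
  have h1 : (α ^ (R ^ 2))⁻¹ ≤ Real.exp ((R : ℝ) ^ 3) := by
    have e1 : Real.exp (-(S * Real.log 2)) ≤ α := by
      have := Real.exp_pos (-(S * Real.log 2))
      have := hP.α_eq
      linarith
    have e2 : Real.exp (-(R : ℝ)) ≤ α := (Real.exp_le_exp.2 (by linarith)).trans e1
    calc (α ^ (R ^ 2))⁻¹ ≤ (Real.exp (-(R : ℝ)) ^ (R ^ 2))⁻¹ := by gcongr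
      _ = Real.exp ((R : ℝ) ^ 3) := by
        rw [← Real.exp_nat_mul, ← Real.exp_neg]
        congr 1
        push_cast; ring
  have h2 : (2 : ℝ) ^ n ≤ Real.exp R := by
    have e1 : (2 : ℝ) ^ n = Real.exp (n * Real.log 2) := by
      rw [Real.exp_nat_mul, Real.exp_log two_pos]
    rw [e1]
    refine Real.exp_le_exp.2 ?_
    have e2 : (n : ℝ) * Real.log 2 ≤ n * Real.log R := by gcongr; linarith
    linarith [hP.n_log_le]
  have h3 : -Real.pi * ((R : ℝ) ^ 4) ^ 2 / (2 * (R : ℝ) ^ 2) ≤ -(3 / 2) * (R : ℝ) ^ 6 := by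
    have e1 : -Real.pi * ((R : ℝ) ^ 4) ^ 2 / (2 * (R : ℝ) ^ 2) = -(Real.pi / 2) * (R : ℝ) ^ 6 := by
      field_simp
    rw [e1]
    have := Real.pi_gt_three
    have : (0 : ℝ) < (R : ℝ) ^ 6 := by positivity
    nlinarith
  have h4 : (R : ℝ) ^ 3 + R ≤ (R : ℝ) ^ 6 / 2 := by
    have e1 : (128 : ℝ) ≤ (R : ℝ) ^ 3 := by nlinarith [sq_nonneg (R : ℝ)]
    have e2 : (R : ℝ) ≤ (R : ℝ) ^ 3 := by nlinarith [sq_nonneg (R : ℝ)]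
    have e3 : (R : ℝ) ^ 6 = (R : ℝ) ^ 3 * (R : ℝ) ^ 3 := by ring
    nlinarith
  have h5 : Real.exp (-(R : ℝ) ^ 6) ≤ ((R : ℝ) ^ 6)⁻¹ := by
    rw [Real.exp_neg]
    refine inv_anti₀ (by positivity) ?_
    linarith [Real.add_one_le_exp ((R : ℝ) ^ 6)]
  calc ((R ^ 2 : ℕ) : ℝ) * ((α ^ (R ^ 2))⁻¹ *
        (2 ^ n * Real.exp (-Real.pi * ((R : ℝ) ^ 4) ^ 2 / (2 * (R : ℝ) ^ 2))))
      ≤ (R : ℝ) ^ 2 * (Real.exp ((R : ℝ) ^ 3) * (Real.exp R *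
          Real.exp (-(3 / 2) * (R : ℝ) ^ 6))) := by
        push_cast
        gcongr
    _ = (R : ℝ) ^ 2 * Real.exp ((R : ℝ) ^ 3 + R - 3 / 2 * (R : ℝ) ^ 6) := by
      rw [← Real.exp_add, ← Real.exp_add]
      ring_nf
    _ ≤ (R : ℝ) ^ 2 * Real.exp (-(R : ℝ) ^ 6) := by
      gcongr
      linarith
    _ ≤ (R : ℝ) ^ 2 * ((R : ℝ) ^ 6)⁻¹ := by gcongr
    _ = (R : ℝ)⁻¹ * ((R : ℝ) ^ 3)⁻¹ := by field_simp
    _ ≤ (R : ℝ)⁻¹ * (1 / 2) := by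
      gcongr
      rw [one_div]
      refine inv_anti₀ two_pos ?_
      nlinarith [sq_nonneg (R : ℝ)]
    _ ≤ X / 2 := by linarith

/-- The analytic half: if the frequencies of small defect are almost orthogonal to `v`, the
convolution is almost invariant under translation by `v`. -/
theorem dTV_convolution_translate_le {C C' : ℝ} (hC' : 0 < C') {n R : ℕ} {α S : ℝ}
    (hkernel : ∀ a : ℝ, 0 < a → a ≤ 1 / 3 → ∃ w : ℤ → ℝ,
      Summable (fun p => |w p|) ∧ ∑' p, |w p| ≤ C' * a ^ (1 / 5 : ℝ) ∧
      ∀ θ : UnitAddCircle, ‖θ‖ ≤ a → ∑' p : ℤ, (w p : ℂ) * fourier p θ = 1 - fourier 1 θ)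
    (hL : IsLarge C C' R) (hP : Params n R α S) (hα : 0 < α)
    {a : Fin (R ^ 2) → ℝ} (ha : ∀ i, 0 < a i ∧ a i ≤ 1) (hprod : α ^ (R ^ 2) ≤ ∏ i, a i)
    {μ : Fin (R ^ 2) → Measure (Lat n)} (hμ : ∀ i, IsProbabilityMeasure (μ i))
    (hpiece : ∀ i, IsDensePiece (a i) (μ i) (discreteGaussian n R)) {v : Lat n}
    (hvn : ‖v‖ ≤ R)
    (hv : ∀ t : Torus n, ∑ i, (1 - ‖ft (μ i) t‖ ^ 2) ≤ (R : ℝ) →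
      ‖pairing v t‖ ≤ (R : ℝ) ^ (-(1 / 3) : ℝ)) :
    dTV (convolution μ) (translate v (convolution μ)) ≤ (R : ℝ) ^ (-(1 / 50) : ℝ) := by
  have hx1 : (128 : ℝ) ≤ R := by linarith [hL.h_lin]
  have hx0 : (0 : ℝ) < R := by linarith
  have hprob := isProbabilityMeasure_convolution μ hμ
  have ha3 : (R : ℝ) ^ (-(1 / 3) : ℝ) ≤ 1 / 3 := by
    calc (R : ℝ) ^ (-(1 / 3) : ℝ) ≤ 27 ^ (-(1 / 3) : ℝ) :=
          Real.rpow_le_rpow_of_nonpos (by norm_num) (by linarith) (by norm_num)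
      _ = 1 / 3 := by
        rw [show (27 : ℝ) = 3 ^ (3 : ℝ) by norm_num, ← Real.rpow_mul (by norm_num)]
        norm_num [Real.rpow_neg_one]
  obtain ⟨w, hw, hwsum, hker⟩ := hkernel _ (Real.rpow_pos_of_pos hx0 _) ha3
  have htail := convolution_tail_of_densePiece (T := (R : ℝ) ^ 4) hx0 (by positivity) hμ ha hα hprod
    hpiece
  have hN : ((R ^ 2 : ℕ) : ℝ) * (R : ℝ) ^ 4 + ‖v‖ ≤ ((R ^ 6 + R : ℕ) : ℝ) := by
    push_cast; nlinarith
  have hmain := dTV_translate_le (μ := convolution μ) (Real.exp_pos (-(R : ℝ) / 2)).le hw hker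
    (v := v) (fun t ht => norm_ft_convolution_le hμ (le_of_not_ge fun hle =>
      absurd (hv t hle) (not_le.2 ht))) htail hN
  refine hmain.trans ?_
  set W := ∑' p, |w p| with hW
  have hWC : W ≤ C' := by
    refine hwsum.trans (mul_le_of_le_one_right hC'.le ?_)
    exact Real.rpow_le_one (by positivity) (ha3.trans (by norm_num)) (by norm_num)
  have hWX := hwsum.trans (kernel_bound_le hL hx0)
  have hboxterm := box_term_le hL hP hC' (tsum_nonneg fun _ => abs_nonneg _) hWC
  have htailterm := tail_term_le hL hP hx1
  linarith

end LatticeTV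

theorem mainTheorem8 :
    ∃ R₀ : ℕ, ∀ (n R : ℕ), R₀ ≤ R → n ^ 50 ≤ R →
      ∀ (α S : ℝ), 0 < α → α ≤ 1 → S = Real.logb 2 (2 / α) → S ≤ n * Real.logb 2 R →
      ∀ (a : Fin (R ^ 2) → ℝ), (∀ i, 0 < a i ∧ a i ≤ 1) → α ^ (R ^ 2) ≤ ∏ i, a i →
      ∀ (μ : Fin (R ^ 2) → MeasureTheory.Measure (LatticeTV.Lat n)),
        (∀ i, MeasureTheory.IsProbabilityMeasure (μ i)) →
        (∀ i, LatticeTV.IsDensePiece (a i) (μ i) (LatticeTV.discreteGaussian n R)) →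
      ∃ (m : ℕ) (t : Fin m → LatticeTV.Torus n) (k : Fin m → ℕ),
        (m : ℝ) ≤ 14 * S ∧
        (∀ j, 1 ≤ k j) ∧
        (∏ j, (k j : ℝ)) ≤ (1000 * (1 + S / Real.logb 2 R)) ^ (672 * S) ∧
        (∀ j, ∃ c : Fin m → ℕ, (∀ i, i < j → c i < k i) ∧
          k j • t j = ∑ i ∈ Finset.univ.filter (fun i => i < j), c i • t i) ∧
        (∀ v : LatticeTV.Lat n, v ≠ 0 →
          (∀ j, LatticeTV.pairing v (t j) = 0) →
          LatticeTV.l2norm v ≤ (R : ℝ) ^ (1 / 3 : ℝ) →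
          LatticeTV.dTV (LatticeTV.convolution μ)
              (LatticeTV.translate v (LatticeTV.convolution μ))
            ≤ (R : ℝ) ^ (-(1 / 50) : ℝ)) := by
  obtain ⟨C, hC, hdecay⟩ := LatticeTV.exists_ft_discreteGaussian_decay
  obtain ⟨C', hC', hkernel⟩ := LatticeTV.exists_difference_kernel
  obtain ⟨R₀, hR₀⟩ := Filter.eventually_atTop.1
    (tendsto_natCast_atTop_atTop.eventually (LatticeTV.eventually_isLarge C C'))
  refine ⟨R₀, fun n R hRR hn α S hα hα1 hS hSn a ha hprod μ hμ hpiece => ?_⟩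
  have hL : LatticeTV.IsLarge C C' R := hR₀ R hRR
  have hP := LatticeTV.params_of_isLarge hL hC' hn hα hα1 hS hSn
  have hx1 : (128 : ℝ) ≤ R := by linarith [hL.h_lin]
  have hx0 : (0 : ℝ) < R := by linarith
  obtain ⟨m, t, k, hm, hk1, hk, hrel, hcov⟩ := LatticeTV.exists_generators_of_pieces hC hC'
    (hdecay n R (by linarith)) hL hP hα hα1 ha hprod hμ hpiece
  refine ⟨m, fun j => t j, fun j => k j, hm, fun j => hk1 j j.2, ?_, ?_, ?_⟩
  · rw [Fin.prod_univ_eq_prod_range (fun j => (k j : ℝ)) m]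
    exact_mod_cast hk
  · intro j
    obtain ⟨c, hc, hsum⟩ := hrel j j.2
    refine ⟨fun i => c i, fun i hi => hc i hi, hsum.trans ?_⟩
    rw [Finset.sum_filter]
    refine Eq.trans ?_ (Fin.sum_univ_eq_sum_range
      (fun i => if i < (j : ℕ) then c i • t i else 0) m).symm
    rw [← Finset.sum_filter]
    refine Finset.sum_congr ?_ fun _ _ => rfl
    ext i
    have := j.2
    simp only [Finset.mem_range, Finset.mem_filter]
    omega
  · intro v _ hvt hvn
    have hvR : LatticeTV.l2norm v ≤ R := hvn.trans (by
      calc (R : ℝ) ^ (1 / 3 : ℝ) ≤ (R : ℝ) ^ (1 : ℝ) :=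
            Real.rpow_le_rpow_of_exponent_le (by linarith) (by norm_num)
        _ = R := Real.rpow_one _)
    refine LatticeTV.dTV_convolution_translate_le hC' hkernel hL hP hα ha hprod hμ hpiece
      ((LatticeTV.norm_le_l2norm v).trans hvR) fun x hx => ?_
    obtain ⟨b, hb⟩ := hcov x hx
    set h := ∑ i ∈ Finset.range m, b i • t i with hh
    have hv0 : LatticeTV.pairing v h = 0 := by
      have hadd : ∀ s : Finset ℕ, (∀ i ∈ s, i < m) →
          LatticeTV.pairing v (∑ i ∈ s, b i • t i) = 0 := by
        intro s hs
        simp only [LatticeTV.pairing, Finset.sum_apply, Pi.smul_apply, Finset.smul_sum]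
        rw [Finset.sum_comm]
        refine Finset.sum_eq_zero fun i hi => ?_
        have h1 := hvt ⟨i, hs i hi⟩
        simp only [LatticeTV.pairing] at h1
        simp_rw [smul_comm _ (b i)]
        rw [← Finset.smul_sum, h1, smul_zero]
      exact hadd _ fun i hi => Finset.mem_range.1 hi
    have hsplit : LatticeTV.pairing v x = LatticeTV.pairing v (x - h) := by
      have := LatticeTV.pairing_add_right v (x - h) h
      rwa [sub_add_cancel, hv0, add_zero] at this
    rw [hsplit]
    calc ‖LatticeTV.pairing v (x - h)‖ ≤ n * LatticeTV.l2norm v * ‖x - h‖ :=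
          LatticeTV.norm_pairing_le _ _
      _ ≤ (R : ℝ) ^ (1 / 50 : ℝ) * (R : ℝ) ^ (1 / 3 : ℝ) * (R : ℝ) ^ (-(73 / 100) : ℝ) := by
        have hl0 : 0 ≤ LatticeTV.l2norm v := norm_nonneg _
        have := hP.n_le
        gcongr
      _ = (R : ℝ) ^ (1 / 50 + 1 / 3 + -(73 / 100) : ℝ) := by
        rw [← Real.rpow_add hx0, ← Real.rpow_add hx0]
      _ ≤ _ := Real.rpow_le_rpow_of_exponent_le (by linarith) (by norm_num)

end
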